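/- For $n\ge 1$ let $\pi_n$ be a permutation chosen uniformly at random from the symmetric group of $\{1,\dots,n\}$ (all $\pi_n$ being defined on one probability space $(\Omega,\mathbb P)$). Let $D_n$ be the number of descents of $\pi_n$, that is, of $k\in\{1,\dots,n-1\}$ with $\pi_n(k)>\pi_n(k+1)$, and let $D_n'$ be the number of descents of $\pi_n^{-1}$. Put $$L(t)=\log\Big(\frac{e^t-1}{t}\Big)\ (t\ne 0),\quad L(0)=0,\qquad I(x)=\sup_{t\in\mathbb R}\{xt-L(t)\},\quad I(x,y)=I(x)+I(y),\qquad \{x_n\}=nx-\lceil (n-1)x\rceil .$$ Let $x,y\in\,]1/2,1[$. Then $I(x)$ and $I(y)$ are finite, the equations $L'(t)=x$ and $L'(t)=y$ have unique real solutions $t_x$ and $t_y$, and $t_x>0$, $t_y>0$, $L''(t_x)>0$, $L''(t_y)>0$. Let $\sigma_x,\sigma_y>0$ be given by $\sigma_x^2=L''(t_x)$, $\sigma_y^2=L''(t_y)$, and let $$\varphi_n(x,y)=\{x_n\}t_x+\{y_n\}t_y+\tfrac12 t_xt_y,\qquad \phi_n(x,y)=\{x_n\}t_x+\{y_n\}t_y-\tfrac12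 t_xt_y .$$ Then, as $n\to\infty$, $$\mathbb P\Big(\frac{D_n}{n-1}\ge x,\ \frac{D_n'}{n-1}\ge y\Big)=\frac{\exp(-nI(x,y)+\varphi_n(x,y))}{2\pi n\,\sigma_xt_x\sigma_yt_y}\,[1+o(1)],$$ $$\mathbb P\Big(\frac{D_n}{n-1}\le 1-x,\ \frac{D_n'}{n-1}\le 1-y\Big)=\frac{\exp(-nI(x,y)+\varphi_n(x,y))}{2\pi n\,\sigma_xt_x\sigma_yt_y}\,[1+o(1)],$$ $$\mathbb P\Big(\frac{D_n}{n-1}\le 1-x,\ \frac{D_n'}{n-1}\ge y\Big)=\frac{\exp(-nI(x,y)+\phi_n(x,y))}{2\pi n\,\sigma_xt_x\sigma_yt_y}\,[1+o(1)],$$ $$\mathbb P\Big(\frac{D_n}{n-1}\ge x,\ \frac{D_n'}{n-1}\le 1-y\Big)=\frac{\exp(-nI(x,y)+\phi_n(x,y))}{2\pi n\,\sigma_xt_x\sigma_yt_y}\,[1+o(1)].$$ -/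

import Mathlib

open MeasureTheory Filter Asymptotics

noncomputable section

/-- The number of descents of a permutation `σ` of an `n`-element chain: the number of
positions `k` having a successor `k + 1` with `σ k > σ (k + 1)`. -/
def descents {n : ℕ} (σ : Equiv.Perm (Fin n)) : ℕ :=
  Fintype.card {k : Fin n // ∃ h : (k : ℕ) + 1 < n, σ ⟨(k : ℕ) + 1, h⟩ < σ k}

/-- `X` is a random permutation of `{1, …, n}` chosen uniformly at random: a measurable map
(for the discrete structure on permutations) taking each value with probability `1 / n!`. -/
def IsUniformPerm {Ω : Type*} [MeasurableSpace Ω] (P : Measure Ω) {n : ℕ}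
    (X : Ω → Equiv.Perm (Fin n)) : Prop :=
  ∀ σ : Equiv.Perm (Fin n), MeasurableSet {ω | X ω = σ} ∧
    P.real {ω | X ω = σ} = 1 / (n.factorial : ℝ)

/-- The limiting cumulant generating function `L(t) = log ((exp t - 1) / t)`, extended
by continuity with `L(0) = 0`. -/
def cumulantL (t : ℝ) : ℝ :=
  if t = 0 then 0 else Real.log ((Real.exp t - 1) / t)

/-- The rate function `I(x) = sup_t (x t - L(t))`, at points where this supremum is finite. -/
def rateI (x : ℝ) : ℝ := ⨆ t : ℝ, (x * t - cumulantL t)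

/-- The joint rate function `I(x, y) = I(x) + I(y)`. -/
def rateI₂ (x y : ℝ) : ℝ := rateI x + rateI y

/-- `{x_n} = n x - ⌈(n - 1) x⌉`. -/
def fracN (n : ℕ) (x : ℝ) : ℝ := n * x - (⌈((n : ℝ) - 1) * x⌉ : ℤ)

end

/-! The proof combines an exact formula with a saddle-point analysis. Counting lexicographically
increasing sequences of pairs in two ways gives the Carlitz–Roselle–Scoville identity
`sum_choose_mul_choose`, whose left side is a sum over permutations of products of binomials
depending on one descent number each. Its right side is a rising factorial in `k * l`, hence a
combination of powers `(k * l) ^ (N - m)`, in which the variables separate. Here `N` is the size of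
the permutations.

Taking `N`-th backward differences in `k` and in `l` turns the binomials into indicators of `des σ <
a` and `des σ⁻¹ < b`. So (`card_descents_lt`) the joint distribution function is the sum over `m` of
`w(N, m) S_m(a) S_m(b)`, where `w` is `stirlingWeight` and `S_m` is `splineDiff`. The term `S_0` is
the distribution function of a sum of `N` independent uniform variables, so `m = 0` alone would make
the two descent numbers independent; the other terms carry the correlation. The reflection
`splineDiff_reflect` yields the mixed tails at the price of a sign `(-1) ^ m`.

Laplace inversion writes `S_m(a)` as an integral over a vertical line, which is placed at the saddle
`t` with `L'(t) = x`. There the integrand is the `N`-th power of the characteristic function of a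
centred tilted uniform law, times `z ^ m / z`. By the central limit theorem its mass concentrates at
`z = t`, so `S_m` behaves like `t ^ m S_0`.

Since `w(N, m)` tends to `1 / (2 ^ m m!)`, the sum over `m` becomes the exponential series of `± t_x
t_y / 2`, the extra term in the exponent. The interchange of limit and sum rests on
`stirlingWeight_le` and `exists_norm_saddleIntegral_le`, which together bound the `m`-th term by a
constant times `C ^ m / m!`. -/

/-! ### Compatible sequences and the Carlitz–Roselle–Scoville identity -/

/-- `u` is weakly increasing, and strictly increasing across the descents of `σ`. -/
def IsCompatible {n : ℕ} {α : Type*} [LinearOrder α] (σ : Equiv.Perm (Fin n)) (u : Fin n → α) :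
    Prop :=
  StrictMono fun i => toLex (u i, σ i)

theorem isCompatible_succ_iff {n : ℕ} {α : Type*} [LinearOrder α] (σ : Equiv.Perm (Fin (n + 1)))
    (u : Fin (n + 1) → α) :
    IsCompatible σ u ↔ ∀ i : Fin n, u i.castSucc ≤ u i.succ ∧
      (σ i.succ < σ i.castSucc → u i.castSucc < u i.succ) := by
  rw [IsCompatible, Fin.strictMono_iff_lt_succ]
  refine forall_congr' fun i => ?_
  rw [Prod.Lex.toLex_lt_toLex]
  have hne : σ i.castSucc ≠ σ i.succ := fun h =>
    (Fin.castSucc_lt_succ (i := i)).ne (σ.injective h)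
  simp only
  constructor
  · rintro (h | ⟨h, h'⟩)
    · exact ⟨h.le, fun _ => h⟩
    · exact ⟨h.le, fun h'' => absurd h' h''.not_gt⟩
  · rintro ⟨h, h'⟩
    rcases h.lt_or_eq with h1 | h1
    · exact Or.inl h1
    · refine Or.inr ⟨h1, lt_of_le_of_ne (not_lt.1 fun h2 => ?_) hne⟩
      exact (h' h2).ne h1

/-- The number of descents of `σ` at positions before `r`. -/
def descentsBefore {n : ℕ} (σ : Equiv.Perm (Fin (n + 1))) (r : Fin (n + 1)) : ℕ :=
  (Finset.univ.filter fun i : Fin n => i.castSucc < r ∧ σ i.succ < σ i.castSucc).card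

theorem descents_eq_card {n : ℕ} (σ : Equiv.Perm (Fin (n + 1))) :
    descents σ = (Finset.univ.filter fun i : Fin n => σ i.succ < σ i.castSucc).card := by
  rw [descents, ← Fintype.card_subtype]
  refine Fintype.card_congr
    { toFun := fun k => ⟨⟨k.1, by obtain ⟨h, -⟩ := k.2; omega⟩, by
        obtain ⟨k, h, h'⟩ := k
        exact h'⟩
      invFun := fun i => ⟨i.1.castSucc, by simp, i.2⟩
      left_inv := fun k => rfl
      right_inv := fun i => rfl }

theorem descentsBefore_zero {n : ℕ} (σ : Equiv.Perm (Fin (n + 1))) :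
    descentsBefore σ 0 = 0 := by
  simp [descentsBefore]

theorem descentsBefore_last {n : ℕ} (σ : Equiv.Perm (Fin (n + 1))) :
    descentsBefore σ (Fin.last n) = descents σ := by
  rw [descents_eq_card, descentsBefore]
  congr 1
  ext i
  simp [Fin.castSucc_lt_last]

theorem descentsBefore_succ {n : ℕ} (σ : Equiv.Perm (Fin (n + 1))) (i : Fin n) :
    descentsBefore σ i.succ =
      descentsBefore σ i.castSucc + if σ i.succ < σ i.castSucc then 1 else 0 := by
  unfold descentsBefore
  have : (Finset.univ.filter fun j : Fin n => j.castSucc < i.succ ∧ σ j.succ < σ j.castSucc) =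
      (Finset.univ.filter fun j : Fin n => j.castSucc < i.castSucc ∧ σ j.succ < σ j.castSucc) ∪
        (if σ i.succ < σ i.castSucc then {i} else ∅) := by
    ext j
    have h1 : j.castSucc < i.succ ↔ (j.castSucc < i.castSucc ∨ j = i) := by
      simp only [Fin.lt_def, Fin.ext_iff, Fin.val_castSucc, Fin.val_succ]
      omega
    split_ifs with h <;> simp only [Finset.mem_union, Finset.mem_filter, Finset.mem_univ, true_and,
      Finset.mem_singleton, Finset.notMem_empty, or_false, h1]
    · constructor
      · rintro ⟨h2 | h2, h3⟩
        · exact Or.inl ⟨h2, h3⟩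
        · exact Or.inr h2
      · rintro (h2 | h2)
        · exact ⟨Or.inl h2.1, h2.2⟩
        · exact ⟨Or.inr h2, h2 ▸ h⟩
    · constructor
      · rintro ⟨h2 | h2, h3⟩
        · exact ⟨h2, h3⟩
        · exact absurd (h2 ▸ h3) h
      · exact fun h2 => ⟨Or.inl h2.1, h2.2⟩
  rw [this, Finset.card_union_of_disjoint]
  · split_ifs <;> simp
  · split_ifs <;> simp

theorem descentsBefore_le {n : ℕ} (σ : Equiv.Perm (Fin (n + 1))) (r : Fin (n + 1)) :
    descentsBefore σ r ≤ r := by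
  induction r using Fin.induction with
  | zero => simp [descentsBefore_zero]
  | succ i ih =>
    rw [descentsBefore_succ]
    simp only [Fin.val_castSucc] at ih
    simp only [Fin.val_succ]
    split_ifs <;> omega

theorem descentsBefore_le_descents {n : ℕ} (σ : Equiv.Perm (Fin (n + 1))) (r : Fin (n + 1)) :
    descentsBefore σ r ≤ descents σ := by
  rw [descents_eq_card, descentsBefore]
  exact Finset.card_le_card fun i hi => by
    simp only [Finset.mem_filter, Finset.mem_univ, true_and] at hi ⊢
    exact hi.2

theorem descents_le_descentsBefore_add {n : ℕ} (σ : Equiv.Perm (Fin (n + 1))) (r : Fin (n + 1)) :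
    descents σ + r ≤ descentsBefore σ r + n := by
  induction r using Fin.reverseInduction with
  | last => simp [descentsBefore_last]
  | cast i ih =>
    rw [descentsBefore_succ] at ih
    simp only [Fin.val_succ] at ih
    simp only [Fin.val_castSucc]
    split_ifs at ih <;> omega

theorem descents_le {n : ℕ} (σ : Equiv.Perm (Fin (n + 1))) : descents σ ≤ n := by
  simpa [descentsBefore_zero] using descents_le_descentsBefore_add σ 0

theorem val_add_le_of_strictMono {n N : ℕ} {g : Fin (n + 1) → Fin N} (hg : StrictMono g)
    (r : Fin (n + 1)) : (g r : ℕ) + n ≤ g (Fin.last n) + r := by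
  induction r using Fin.reverseInduction with
  | last => simp
  | cast i ih =>
    have := hg (Fin.castSucc_lt_succ (i := i))
    simp only [Fin.lt_def, Fin.val_succ, Fin.val_castSucc] at this ih ⊢
    omega

theorem le_val_of_strictMono {n N : ℕ} {g : Fin (n + 1) → Fin N} (hg : StrictMono g)
    (r : Fin (n + 1)) : (r : ℕ) ≤ g r := by
  induction r using Fin.induction with
  | zero => simp
  | succ i ih =>
    have := hg (Fin.castSucc_lt_succ (i := i))
    simp only [Fin.lt_def, Fin.val_succ, Fin.val_castSucc] at this ih ⊢
    omega

/-- Compatible sequences correspond to strictly increasing sequences: add to `u r` the number of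
ascents before `r`. -/
def compatibleEquiv {n : ℕ} (σ : Equiv.Perm (Fin (n + 1))) (k : ℕ) :
    {u : Fin (n + 1) → Fin k // IsCompatible σ u} ≃ (Fin (n + 1) ↪o Fin (k + n - descents σ)) where
  toFun u := OrderEmbedding.ofStrictMono
    (fun r => ⟨u.1 r + r - descentsBefore σ r, by
      have h1 := descentsBefore_le σ r
      have h2 := descents_le_descentsBefore_add σ r
      have h3 := (u.1 r).2
      omega⟩) (by
      rw [Fin.strictMono_iff_lt_succ]
      intro i
      obtain ⟨h, h'⟩ := (isCompatible_succ_iff σ u.1).1 u.2 i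
      have h1 := descentsBefore_le σ i.castSucc
      have h2 := descentsBefore_succ σ i
      simp only [Fin.lt_def, Fin.le_def, Fin.val_succ, Fin.val_castSucc] at h h' h1 ⊢
      split_ifs at h2 with h3
      · have := h' h3
        omega
      · omega)
  invFun g := ⟨fun r => ⟨g r + descentsBefore σ r - r, by
      have h1 := descentsBefore_le_descents σ r
      have h2 := val_add_le_of_strictMono g.strictMono r
      have h3 := (g (Fin.last n)).2
      have h4 := le_val_of_strictMono g.strictMono r
      omega⟩, by
      rw [isCompatible_succ_iff]
      intro i
      have h1 := le_val_of_strictMono g.strictMono i.castSucc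
      have h3 := le_val_of_strictMono g.strictMono i.succ
      have h2 := descentsBefore_succ σ i
      have h := g.strictMono (Fin.castSucc_lt_succ (i := i))
      simp only [Fin.lt_def, Fin.le_def, Fin.val_succ, Fin.val_castSucc] at h h1 h3 ⊢
      split_ifs at h2 with h4
      · simp only [Fin.lt_def] at h4
        omega
      · simp only [Fin.lt_def] at h4
        omega⟩
  left_inv u := by
    ext r
    have h1 := descentsBefore_le σ r
    simp only [OrderEmbedding.coe_ofStrictMono]
    omega
  right_inv g := by
    ext r
    have h1 := descentsBefore_le σ r
    have h4 := le_val_of_strictMono g.strictMono r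
    simp only [OrderEmbedding.coe_ofStrictMono]
    omega

theorem natCard_orderEmbedding_fin (n N : ℕ) : Nat.card (Fin n ↪o Fin N) = N.choose n := by
  rw [Nat.card_congr (Set.powersetCard.ofFinEmbEquiv (I := Fin N) (n := n)),
    Set.powersetCard.card, Nat.card_fin]

theorem natCard_isCompatible {n : ℕ} (σ : Equiv.Perm (Fin (n + 1))) (k : ℕ) :
    Nat.card {u : Fin (n + 1) → Fin k // IsCompatible σ u} = (k + n - descents σ).choose (n + 1) := by
  rw [Nat.card_congr (compatibleEquiv σ k), natCard_orderEmbedding_fin]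

theorem descents_one {n : ℕ} : descents (1 : Equiv.Perm (Fin n)) = 0 := by
  rw [descents, Fintype.card_eq_zero_iff]
  refine ⟨fun k => ?_⟩
  obtain ⟨k, h, h'⟩ := k
  simp only [Equiv.Perm.coe_one, id, Fin.lt_def] at h'
  omega

theorem isCompatible_one_iff {n : ℕ} {α : Type*} [LinearOrder α] (u : Fin n → α) :
    IsCompatible 1 u ↔ Monotone u := by
  rw [IsCompatible]
  constructor
  · intro h i j hij
    have := StrictMono.monotone h hij
    rw [Prod.Lex.toLex_le_toLex] at this
    rcases this with h | h
    · exact h.le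
    · exact h.1.le
  · intro h i j hij
    rw [Prod.Lex.toLex_lt_toLex]
    rcases (h hij.le).lt_or_eq with h1 | h1
    · exact Or.inl h1
    · exact Or.inr ⟨h1, hij⟩

theorem natCard_monotone_fin (n N : ℕ) :
    Nat.card {u : Fin (n + 1) → Fin N // Monotone u} = (N + n).choose (n + 1) := by
  have := natCard_isCompatible (1 : Equiv.Perm (Fin (n + 1))) N
  rw [descents_one] at this
  rw [← Nat.sub_zero (N + n), ← this]
  exact Nat.card_congr (Equiv.subtypeEquivRight fun u => (isCompatible_one_iff u).symm)

/-- The lexicographic product is a chain of `k * l` elements, so only the size of the chain matters.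
-/
theorem natCard_monotone_lex (n k l : ℕ) :
    Nat.card {p : Fin (n + 1) → Fin k ×ₗ Fin l // Monotone p} = (k * l + n).choose (n + 1) := by
  rw [← natCard_monotone_fin]
  have hc : Fintype.card (Fin k ×ₗ Fin l) = k * l := by
    rw [Fintype.card_congr (ofLex (α := Fin k × Fin l)), Fintype.card_prod, Fintype.card_fin,
      Fintype.card_fin]
  let e := Fintype.orderIsoFinOfCardEq (Fin k ×ₗ Fin l) hc
  refine Nat.card_congr (Equiv.symm ?_)
  refine Equiv.subtypeEquiv (Equiv.piCongrRight fun _ => e.toEquiv) fun u => ?_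
  constructor
  · intro h i j hij
    exact e.monotone (h hij)
  · intro h i j hij
    exact e.le_iff_le.1 (h hij)

theorem IsCompatible.monotone {n : ℕ} {α : Type*} [LinearOrder α] {σ : Equiv.Perm (Fin n)}
    {u : Fin n → α} (h : IsCompatible σ u) : Monotone u := by
  intro i j hij
  have := StrictMono.monotone h hij
  rw [Prod.Lex.toLex_le_toLex] at this
  rcases this with h | h
  · exact h.le
  · exact h.1.le

/-- Compatibility is exactly the tie-breaking rule of stable sorting, so each word `w` has a unique
permutation that sorts it compatibly. -/
theorem isCompatible_comp_iff {n : ℕ} {α : Type*} [LinearOrder α] (σ : Equiv.Perm (Fin n))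
    (w : Fin n → α) : IsCompatible σ (w ∘ σ) ↔ σ = Tuple.sort w := by
  rw [Tuple.eq_sort_iff']
  exact Iff.rfl

theorem compatiblePair_ext {n k l : ℕ}
    {x y : Σ σ : Equiv.Perm (Fin n), {u : Fin n → Fin k // IsCompatible σ u} ×
      {v : Fin n → Fin l // IsCompatible σ⁻¹ v}} (h : x.1 = y.1) (h₁ : x.2.1.1 = y.2.1.1)
    (h₂ : x.2.2.1 = y.2.2.1) : x = y := by
  obtain ⟨σ, ⟨u, hu⟩, ⟨v, hv⟩⟩ := x
  obtain ⟨τ, ⟨u', hu'⟩, ⟨v', hv'⟩⟩ := y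
  simp only at h h₁ h₂
  subst h h₁ h₂
  rfl

/-- A pair of sequences compatible with `σ` and `σ⁻¹` amounts to a lexicographically increasing
sequence of pairs. -/
def compatiblePairEquiv (n k l : ℕ) :
    (Σ σ : Equiv.Perm (Fin n), {u : Fin n → Fin k // IsCompatible σ u} ×
      {v : Fin n → Fin l // IsCompatible σ⁻¹ v}) ≃ {p : Fin n → Fin k ×ₗ Fin l // Monotone p} where
  toFun x := ⟨fun r => toLex (x.2.1.1 r, x.2.2.1 (x.1 r)), by
    intro i j hij
    have h := StrictMono.monotone x.2.1.2 hij
    simp only [Prod.Lex.toLex_le_toLex] at h ⊢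
    rcases h with h | ⟨h, h'⟩
    · exact Or.inl h
    · exact Or.inr ⟨h, IsCompatible.monotone x.2.2.2 h'⟩⟩
  -- The stable sort of the second coordinates is `σ⁻¹`. Where the first coordinate is constant the
  -- second is weakly increasing, and stability then makes `σ` increase there.
  invFun p := ⟨(Tuple.sort fun r => (ofLex (p.1 r)).2)⁻¹, ⟨fun r => (ofLex (p.1 r)).1, by
    set w := fun r => (ofLex (p.1 r)).2 with hw
    have hs := (isCompatible_comp_iff (Tuple.sort w) w).2 rfl
    intro i j hij
    rw [Prod.Lex.toLex_lt_toLex]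
    have h := p.2 hij.le
    rw [Prod.Lex.le_iff] at h
    rcases h with h | ⟨h, h'⟩
    · exact Or.inl h
    · refine Or.inr ⟨h, ?_⟩
      rw [← hs.lt_iff_lt, Prod.Lex.toLex_lt_toLex]
      rcases h'.lt_or_eq with h1 | h1
      · left; simpa [hw] using h1
      · right; exact ⟨by simpa [hw] using h1, by simpa using hij⟩⟩,
    ⟨fun r => (ofLex (p.1 (Tuple.sort (fun r => (ofLex (p.1 r)).2) r))).2, by
    rw [inv_inv]
    exact (isCompatible_comp_iff _ _).2 rfl⟩⟩
  left_inv := by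
    rintro ⟨σ, ⟨u, hu⟩, ⟨v, hv⟩⟩
    have h : Tuple.sort (v ∘ σ) = σ⁻¹ := by
      symm
      rw [← isCompatible_comp_iff]
      convert hv using 1
      ext r; simp
    have h' : (Tuple.sort (v ∘ σ))⁻¹ = σ := by rw [h, inv_inv]
    refine compatiblePair_ext h' rfl ?_
    ext r
    change (v (σ (Tuple.sort (v ∘ σ) r)) : ℕ) = v r
    rw [h]
    simp
  right_inv := by
    rintro ⟨p, hp⟩
    ext r
    simp

theorem sum_choose_mul_choose (n k l : ℕ) :
    ∑ σ : Equiv.Perm (Fin (n + 1)), (k + n - descents σ).choose (n + 1) *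
      (l + n - descents σ⁻¹).choose (n + 1) = (k * l + n).choose (n + 1) := by
  rw [← natCard_monotone_lex, ← Nat.card_congr (compatiblePairEquiv (n + 1) k l), Nat.card_sigma]
  refine Finset.sum_congr rfl fun σ _ => ?_
  rw [Nat.card_prod, natCard_isCompatible, natCard_isCompatible]

/-! ### Backward differences and the exact joint distribution of descents -/

noncomputable section

/-- The `n`-th backward difference of `f` at `a`. -/
def bwdDiff (n : ℕ) (f : ℤ → ℝ) (a : ℤ) : ℝ :=
  ∑ r ∈ Finset.range (n + 1), (-1) ^ r * (n.choose r : ℝ) * f (a - r)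

/-- The truncated power `x₊ ^ N / N!`. -/
def truncPow (N : ℕ) (x : ℝ) : ℝ := max x 0 ^ N / N.factorial

/-- The `n`-th backward difference of the truncated power of degree `n - m`. -/
def splineDiff (n m : ℕ) (a : ℤ) : ℝ := bwdDiff n (fun k => truncPow (n - m) k) a

/-- The coefficient `|s(n, n - m)| ((n - m)! / n!) ^ 2`, with `s` the Stirling numbers of the
first kind. -/
def stirlingWeight (n m : ℕ) : ℝ :=
  ((ascPochhammer ℕ n).coeff (n - m) : ℝ) * ((n - m).factorial / n.factorial) ^ 2

end

theorem bwdDiff_eq_fwdDiff (n : ℕ) (f : ℤ → ℝ) (a : ℤ) :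
    bwdDiff n f a = (-1) ^ n * (fwdDiff (-1 : ℤ))^[n] f a := by
  rw [fwdDiff_iter_eq_sum_shift, bwdDiff, Finset.mul_sum]
  refine Finset.sum_congr rfl fun r hr => ?_
  have hr' : r ≤ n := by simpa [Nat.lt_succ_iff] using hr
  obtain ⟨s, rfl⟩ := Nat.exists_eq_add_of_le hr'
  have h : ((-1 : ℝ) ^ s) * (-1) ^ s = 1 := by rw [← mul_pow]; simp
  simp only [Nat.add_sub_cancel_left, zsmul_eq_mul, nsmul_eq_mul, mul_neg, mul_one,
    ← sub_eq_add_neg, pow_add]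
  push_cast
  linear_combination (-(-1 : ℝ) ^ r * ((r + s).choose r : ℝ) * f (a - r)) * h

theorem bwdDiff_zero (f : ℤ → ℝ) (a : ℤ) : bwdDiff 0 f a = f a := by
  simp [bwdDiff]

theorem bwdDiff_succ (n : ℕ) (f : ℤ → ℝ) (a : ℤ) :
    bwdDiff (n + 1) f a = bwdDiff n (fun k => f k - f (k - 1)) a := by
  have h : (fun k => f k - f (k - 1)) = (-1 : ℝ) • fwdDiff (-1 : ℤ) f := by
    ext k
    simp [fwdDiff, ← sub_eq_add_neg]
  rw [bwdDiff_eq_fwdDiff, bwdDiff_eq_fwdDiff, h, fwdDiff_iter_const_smul, Function.iterate_succ_apply,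
    pow_succ]
  simp

theorem bwdDiff_sum {ι : Type*} (s : Finset ι) (n : ℕ) (f : ι → ℤ → ℝ) (a : ℤ) :
    bwdDiff n (fun k => ∑ i ∈ s, f i k) a = ∑ i ∈ s, bwdDiff n (f i) a := by
  simp only [bwdDiff, Finset.mul_sum]
  exact Finset.sum_comm

theorem bwdDiff_const_mul (n : ℕ) (c : ℝ) (f : ℤ → ℝ) (a : ℤ) :
    bwdDiff n (fun k => c * f k) a = c * bwdDiff n f a := by
  simp only [bwdDiff, Finset.mul_sum]
  exact Finset.sum_congr rfl fun _ _ => by ring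

/-- By Pascal's rule each backward difference lowers `n` by one, down to the indicator of `0 ≤ j`.
-/
theorem bwdDiff_choose (n : ℕ) (j : ℤ) :
    bwdDiff n (fun k => if 0 ≤ k then ((k.toNat + n).choose n : ℝ) else 0) j =
      if 0 ≤ j then 1 else 0 := by
  induction n with
  | zero => simp [bwdDiff_zero]
  | succ n ih =>
    rw [bwdDiff_succ, ← ih]
    congr 1
    ext k
    rcases lt_trichotomy k 0 with hk | rfl | hk
    · rw [if_neg (by omega), if_neg (by omega), if_neg (by omega), sub_zero]
    · simp
    · obtain ⟨i, rfl⟩ : ∃ i : ℕ, k = i + 1 := ⟨(k - 1).toNat, by omega⟩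
      rw [if_pos (by omega), if_pos (by omega), if_pos (by omega)]
      have h1 : ((i : ℤ) + 1).toNat = i + 1 := by omega
      have h2 : ((i : ℤ) + 1 - 1).toNat = i := by omega
      rw [h1, h2]
      have h3 : i + 1 + (n + 1) = (i + n + 1) + 1 := by ring
      have h4 : i + (n + 1) = i + n + 1 := by ring
      have h5 : i + 1 + n = i + n + 1 := by ring
      rw [h3, h4, h5, Nat.choose_succ_succ (i + n + 1) n]
      push_cast
      ring

theorem bwdDiff_shift (n : ℕ) (f : ℤ → ℝ) (c a : ℤ) :
    bwdDiff n (fun k => f (k - c)) a = bwdDiff n f (a - c) := by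
  simp only [bwdDiff]
  exact Finset.sum_congr rfl fun _ _ => by rw [sub_right_comm]

theorem bwdDiff_choose_sub {n d : ℕ} (hd : d ≤ n) (a : ℤ) :
    bwdDiff (n + 1) (fun k => if 0 ≤ k then ((k.toNat + n - d).choose (n + 1) : ℝ) else 0) a =
      if (d : ℤ) < a then 1 else 0 := by
  -- The binomial vanishes for `0 ≤ k ≤ d`, so the function is the one of `bwdDiff_choose` shifted
  -- by `d + 1`.
  have h : (fun k : ℤ => if 0 ≤ k then ((k.toNat + n - d).choose (n + 1) : ℝ) else 0) =
      fun k => (fun k : ℤ => if 0 ≤ k then ((k.toNat + (n + 1)).choose (n + 1) : ℝ) else 0)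
        (k - (d + 1)) := by
    ext k
    simp only
    split_ifs with h1 h2 h2
    · congr 2; omega
    · rw [Nat.choose_eq_zero_of_lt (by omega), Nat.cast_zero]
    · omega
    · rfl
  rw [h]
  refine (bwdDiff_shift (n + 1) (fun k : ℤ => if 0 ≤ k then
    ((k.toNat + (n + 1)).choose (n + 1) : ℝ) else 0) (d + 1) a).trans ?_
  rw [bwdDiff_choose]
  congr 1
  exact propext ⟨fun h => by omega, fun h => by omega⟩

/-- Expansion of the rising factorial. The constant term vanishes, so only positive powers occur,
and these may be replaced by truncated powers that vanish on the nonpositive integers. -/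
theorem factorial_mul_choose_eq_sum {n : ℕ} (hn : n ≠ 0) (x : ℕ) :
    n.factorial * (x + n - 1).choose n =
      ∑ m ∈ Finset.range n, (ascPochhammer ℕ n).coeff (n - m) * x ^ (n - m) := by
  rw [← Nat.ascFactorial_eq_factorial_mul_choose', ← ascPochhammer_nat_eq_ascFactorial,
    Polynomial.eval_eq_sum_range, ascPochhammer_natDegree, Finset.sum_range_succ',
    Polynomial.coeff_zero_eq_eval_zero]
  rw [ascPochhammer_ne_zero_eval_zero ℕ hn, zero_mul, add_zero,
    ← Finset.sum_range_reflect]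
  refine Finset.sum_congr rfl fun m hm => ?_
  have : n - 1 - m + 1 = n - m := by have := Finset.mem_range.1 hm; omega
  rw [this]

theorem truncPow_natCast (N k : ℕ) : truncPow N k = (k : ℝ) ^ N / N.factorial := by
  rw [truncPow, max_eq_left (Nat.cast_nonneg k)]

theorem truncPow_of_nonpos {N : ℕ} (hN : N ≠ 0) {x : ℝ} (hx : x ≤ 0) : truncPow N x = 0 := by
  rw [truncPow, max_eq_right hx, zero_pow hN, zero_div]

theorem sum_descents_choose_eq (n : ℕ) (k l : ℤ) :
    ∑ σ : Equiv.Perm (Fin (n + 1)),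
      (if 0 ≤ k then ((k.toNat + n - descents σ).choose (n + 1) : ℝ) else 0) *
      (if 0 ≤ l then ((l.toNat + n - descents σ⁻¹).choose (n + 1) : ℝ) else 0) =
    ∑ m ∈ Finset.range (n + 1), (n + 1).factorial * stirlingWeight (n + 1) m *
      truncPow (n + 1 - m) k * truncPow (n + 1 - m) l := by
  have hz : ∀ m ∈ Finset.range (n + 1), n + 1 - m ≠ 0 := fun m hm => by
    have := Finset.mem_range.1 hm; omega
  rcases lt_or_ge k 0 with hk | hk
  · rw [Finset.sum_eq_zero, Finset.sum_eq_zero]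
    · intro m hm
      rw [truncPow_of_nonpos (hz m hm) (by exact_mod_cast hk.le)]
      ring
    · intro σ _
      rw [if_neg hk.not_ge, zero_mul]
  rcases lt_or_ge l 0 with hl | hl
  · rw [Finset.sum_eq_zero, Finset.sum_eq_zero]
    · intro m hm
      rw [truncPow_of_nonpos (hz m hm) (x := l) (by exact_mod_cast hl.le)]
      ring
    · intro σ _
      rw [if_neg hl.not_ge, mul_zero]
  lift k to ℕ using hk
  lift l to ℕ using hl
  simp only [Nat.cast_nonneg, if_true, Int.toNat_natCast, Int.cast_natCast]
  have h1 := sum_choose_mul_choose n k l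
  have h2 := factorial_mul_choose_eq_sum (n := n + 1) (by omega) (k * l)
  have h3 : ((n + 1).factorial : ℝ) ≠ 0 := by positivity
  have h1' := congrArg (Nat.cast : ℕ → ℝ) h1
  have h2' := congrArg (Nat.cast : ℕ → ℝ) h2
  push_cast at h1' h2'
  rw [h1', ← mul_right_inj' h3]
  rw [show k * l + (n + 1) - 1 = k * l + n by omega] at h2'
  rw [h2', Finset.mul_sum]
  refine Finset.sum_congr rfl fun m _ => ?_
  have h4 : ((n + 1 - m).factorial : ℝ) ≠ 0 := by positivity
  rw [truncPow_natCast, truncPow_natCast, stirlingWeight, mul_pow]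
  field_simp

/-- Both sides of `sum_descents_choose_eq` are differenced `n + 1` times in each variable: the
binomials become indicators, the truncated powers become `splineDiff`. -/
theorem card_descents_lt (n : ℕ) (a b : ℤ) :
    (Nat.card {σ : Equiv.Perm (Fin (n + 1)) // (descents σ : ℤ) < a ∧ (descents σ⁻¹ : ℤ) < b} : ℝ) =
    ∑ m ∈ Finset.range (n + 1), (n + 1).factorial * stirlingWeight (n + 1) m *
      splineDiff (n + 1) m a * splineDiff (n + 1) m b := by
  classical
  have h1 : (Nat.card {σ : Equiv.Perm (Fin (n + 1)) //
      (descents σ : ℤ) < a ∧ (descents σ⁻¹ : ℤ) < b} : ℝ) =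
      ∑ σ : Equiv.Perm (Fin (n + 1)),
        (if (descents σ : ℤ) < a then 1 else 0) * (if (descents σ⁻¹ : ℤ) < b then (1 : ℝ) else 0) := by
    rw [Nat.card_eq_fintype_card, Fintype.card_subtype, Finset.card_filter]
    push_cast
    refine Finset.sum_congr rfl fun σ _ => ?_
    by_cases h : (descents σ : ℤ) < a <;> simp [h]
  have h2 : ∀ σ : Equiv.Perm (Fin (n + 1)),
      (if (descents σ : ℤ) < a then 1 else 0) * (if (descents σ⁻¹ : ℤ) < b then (1 : ℝ) else 0) =
      bwdDiff (n + 1) (fun k => bwdDiff (n + 1) (fun l =>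
        (if 0 ≤ k then ((k.toNat + n - descents σ).choose (n + 1) : ℝ) else 0) *
        (if 0 ≤ l then ((l.toNat + n - descents σ⁻¹).choose (n + 1) : ℝ) else 0)) b) a := by
    intro σ
    simp only [bwdDiff_const_mul, bwdDiff_choose_sub (descents_le σ⁻¹) b]
    rw [← bwdDiff_choose_sub (descents_le σ) a, mul_comm, ← bwdDiff_const_mul]
    simp only [mul_comm]
  rw [h1, Finset.sum_congr rfl fun σ _ => h2 σ, ← bwdDiff_sum]
  simp only [← bwdDiff_sum, sum_descents_choose_eq]
  simp only [bwdDiff_sum, bwdDiff_const_mul]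
  refine Finset.sum_congr rfl fun m _ => ?_
  simp only [splineDiff]
  rw [show (fun k : ℤ => (n + 1).factorial * stirlingWeight (n + 1) m * truncPow (n + 1 - m) k *
      bwdDiff (n + 1) (fun k : ℤ => truncPow (n + 1 - m) k) b) = fun k : ℤ =>
      ((n + 1).factorial * stirlingWeight (n + 1) m *
      bwdDiff (n + 1) (fun k : ℤ => truncPow (n + 1 - m) k) b) * truncPow (n + 1 - m) k from
      funext fun _ => by ring, bwdDiff_const_mul]
  ring

theorem bwdDiff_pow {n N : ℕ} (h : N ≤ n) (a : ℤ) :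
    bwdDiff n (fun k => (k : ℝ) ^ N / N.factorial) a = if N = n then 1 else 0 := by
  have h1 : bwdDiff n (fun k => (k : ℝ) ^ N) a =
      (fwdDiff (1 : ℝ))^[n] (fun x : ℝ => x ^ N) ((a : ℝ) - n) := by
    rw [fwdDiff_iter_eq_sum_shift, bwdDiff, ← Finset.sum_range_reflect]
    refine Finset.sum_congr rfl fun r hr => ?_
    have hr' : r ≤ n := by simpa [Nat.lt_succ_iff] using hr
    rw [show n + 1 - 1 - r = n - r by omega, Nat.choose_symm hr', zsmul_eq_mul]
    push_cast [hr']
    simp only [nsmul_eq_mul, mul_one]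
    congr 2
    ring
  have h2 : (fun k : ℤ => (k : ℝ) ^ N / N.factorial) = fun k : ℤ => (N.factorial : ℝ)⁻¹ * (k : ℝ) ^ N :=
    funext fun k => by ring
  rw [h2, bwdDiff_const_mul, h1]
  rcases h.lt_or_eq with h | rfl
  · rw [fwdDiff_iter_pow_eq_zero_of_lt h, if_neg h.ne]
    simp
  · rw [fwdDiff_iter_eq_factorial, if_pos rfl]
    have : (N.factorial : ℝ) ≠ 0 := by positivity
    simp [this]

/-! ### Reflection symmetries and the remaining tails -/

theorem truncPow_add_truncPow_neg {N : ℕ} (hN : N ≠ 0) (x : ℝ) :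
    truncPow N x + (-1) ^ N * truncPow N (-x) = x ^ N / N.factorial := by
  rcases le_total x 0 with hx | hx
  · rw [truncPow_of_nonpos hN hx, truncPow, max_eq_left (by linarith), neg_pow x, zero_add,
      ← mul_div_assoc, ← mul_assoc, ← mul_pow]
    simp
  · rw [truncPow_of_nonpos hN (neg_nonpos.2 hx), truncPow, max_eq_left hx, mul_zero, add_zero]

/-- A truncated power and its signed mirror image add up to a full power of degree `n - m`, whose
`n`-th difference is zero unless `m = 0`. -/
theorem splineDiff_reflect {n m : ℕ} (hm : m < n) (b : ℤ) :
    splineDiff n m b + (-1) ^ m * splineDiff n m (n - b) = if m = 0 then 1 else 0 := by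
  have hN : n - m ≠ 0 := by omega
  have h0 := bwdDiff_pow (n := n) (N := n - m) (by omega) b
  have h1 : (if n - m = n then (1 : ℝ) else 0) = if m = 0 then 1 else 0 := by
    congr 1; exact propext ⟨fun h => by omega, fun h => by omega⟩
  rw [← h1, ← h0]
  have h2 : splineDiff n m (n - b) = (-1) ^ n *
      ∑ r ∈ Finset.range (n + 1), (-1) ^ r * (n.choose r : ℝ) * truncPow (n - m) (-((b - r : ℤ) : ℝ)) := by
    rw [splineDiff, bwdDiff, ← Finset.sum_range_reflect, Finset.mul_sum]
    refine Finset.sum_congr rfl fun r hr => ?_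
    have hr' : r ≤ n := by simpa [Nat.lt_succ_iff] using hr
    rw [show n + 1 - 1 - r = n - r by omega, Nat.choose_symm hr']
    have h3 : ((-1 : ℝ)) ^ (n - r) = (-1) ^ n * (-1) ^ r := by
      rw [← pow_add, show n + r = (n - r) + 2 * r by omega, pow_add, pow_mul]
      simp
    rw [h3]
    push_cast [hr']
    rw [show (n : ℝ) - b - (n - r) = -(b - r) by ring]
    ring
  have h4 : ((-1 : ℝ)) ^ m * (-1) ^ n = (-1) ^ (n - m) := by
    rw [← pow_add, show m + n = (n - m) + 2 * m by omega, pow_add, pow_mul]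
    simp
  rw [h2, ← mul_assoc, h4, Finset.mul_sum, splineDiff, bwdDiff, bwdDiff, ← Finset.sum_add_distrib]
  refine Finset.sum_congr rfl fun r _ => ?_
  rw [← truncPow_add_truncPow_neg hN]
  ring

theorem splineDiff_zero {n m : ℕ} (hm : m < n) : splineDiff n m 0 = 0 := by
  rw [splineDiff, bwdDiff]
  refine Finset.sum_eq_zero fun r _ => ?_
  rw [truncPow_of_nonpos (by omega), mul_zero]
  push_cast
  simp

theorem splineDiff_self {n m : ℕ} (hm : m < n) : splineDiff n m n = if m = 0 then 1 else 0 := by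
  rw [← splineDiff_reflect hm n, sub_self, splineDiff_zero hm, mul_zero, add_zero]

/-- The count is the total minus the lower tail in `des σ⁻¹`, and reflection gives `S_m(N) - S_m(b)
= (-1) ^ m S_m(N - b)` with `N = n + 1`. This sign is the origin of `-t_x t_y / 2` in the mixed
tails. -/
theorem card_descents_lt_le (n : ℕ) (a b : ℤ) :
    (Nat.card {σ : Equiv.Perm (Fin (n + 1)) // (descents σ : ℤ) < a ∧ b ≤ (descents σ⁻¹ : ℤ)} : ℝ) =
    ∑ m ∈ Finset.range (n + 1), (n + 1).factorial * ((-1) ^ m * stirlingWeight (n + 1) m *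
      splineDiff (n + 1) m a * splineDiff (n + 1) m ((n + 1 : ℕ) - b)) := by
  classical
  have h1 := card_descents_lt n a (n + 1 : ℕ)
  have h2 := card_descents_lt n a b
  have h3 : Nat.card {σ : Equiv.Perm (Fin (n + 1)) // (descents σ : ℤ) < a ∧
        (descents σ⁻¹ : ℤ) < (n + 1 : ℕ)} =
      Nat.card {σ : Equiv.Perm (Fin (n + 1)) // (descents σ : ℤ) < a ∧ b ≤ (descents σ⁻¹ : ℤ)} +
      Nat.card {σ : Equiv.Perm (Fin (n + 1)) // (descents σ : ℤ) < a ∧ (descents σ⁻¹ : ℤ) < b} := by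
    simp only [Nat.card_eq_fintype_card, Fintype.card_subtype]
    rw [← Finset.card_union_of_disjoint]
    · congr 1
      ext σ
      have := descents_le σ⁻¹
      simp only [Finset.mem_filter, Finset.mem_univ, true_and, Finset.mem_union]
      omega
    · rw [Finset.disjoint_filter]
      intro σ _ h h'
      omega
  have h3' := congrArg (Nat.cast : ℕ → ℝ) h3
  push_cast at h3'
  rw [← sub_eq_iff_eq_add] at h3'
  push_cast at h1
  rw [← h3', h1, h2, ← Finset.sum_sub_distrib]
  refine Finset.sum_congr rfl fun m hm => ?_
  have h4 := splineDiff_self (Finset.mem_range.1 hm)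
  have h5 := splineDiff_reflect (Finset.mem_range.1 hm) b
  push_cast at h4 h5 ⊢
  rw [← h5] at h4
  rw [h4]
  ring

theorem descents_revPerm_mul {n : ℕ} (σ : Equiv.Perm (Fin (n + 1))) :
    descents (Fin.revPerm * σ) + descents σ = n := by
  rw [descents_eq_card, descents_eq_card, ← Finset.card_union_of_disjoint]
  · convert Finset.card_fin n
    ext i
    have : σ i.castSucc ≠ σ i.succ := fun h => (Fin.castSucc_lt_succ (i := i)).ne (σ.injective h)
    simp only [Equiv.Perm.mul_apply, Fin.revPerm_apply, Fin.rev_lt_rev, Finset.mem_union,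
      Finset.mem_filter, Finset.mem_univ, true_and, iff_true]
    exact lt_or_gt_of_ne this
  · rw [Finset.disjoint_filter]
    intro i _ h
    simp only [Equiv.Perm.mul_apply, Fin.revPerm_apply, Fin.rev_lt_rev] at h
    exact h.not_gt

theorem descents_mul_revPerm {n : ℕ} (σ : Equiv.Perm (Fin (n + 1))) :
    descents (σ * Fin.revPerm) + descents σ = n := by
  refine Eq.trans (congrArg (· + descents σ) ?_) (descents_revPerm_mul σ)
  rw [descents_eq_card, descents_eq_card]
  refine Finset.card_bij (fun i _ => i.rev) ?_ (fun _ _ _ _ h => Fin.rev_injective h) ?_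
  · intro i hi
    simpa [Fin.rev_succ, Fin.rev_castSucc] using hi
  · intro i hi
    exact ⟨i.rev, by simpa [Fin.rev_succ, Fin.rev_castSucc] using hi, Fin.rev_rev i⟩

/-- Reversing the values of `σ` exchanges ascents and descents; it reverses the positions of `σ⁻¹`,
which has the same effect there. -/
theorem card_descents_ge_ge (n : ℕ) (a b : ℤ) :
    Nat.card {σ : Equiv.Perm (Fin (n + 1)) // a ≤ (descents σ : ℤ) ∧ b ≤ (descents σ⁻¹ : ℤ)} =
    Nat.card {σ : Equiv.Perm (Fin (n + 1)) // (descents σ : ℤ) < (n + 1 : ℕ) - a ∧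
      (descents σ⁻¹ : ℤ) < (n + 1 : ℕ) - b} := by
  refine Nat.card_congr (Equiv.subtypeEquiv (Equiv.mulLeft Fin.revPerm) fun σ => ?_)
  have h1 := descents_revPerm_mul σ
  have h2 := descents_mul_revPerm σ⁻¹
  have h3 : (Fin.revPerm : Equiv.Perm (Fin (n + 1)))⁻¹ = Fin.revPerm := rfl
  rw [Equiv.coe_mulLeft, mul_inv_rev, h3]
  simp only
  omega

theorem card_descents_ge_lt (n : ℕ) (a b : ℤ) :
    Nat.card {σ : Equiv.Perm (Fin n) // a ≤ (descents σ : ℤ) ∧ (descents σ⁻¹ : ℤ) < b} =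
    Nat.card {σ : Equiv.Perm (Fin n) // (descents σ : ℤ) < b ∧ a ≤ (descents σ⁻¹ : ℤ)} := by
  refine Nat.card_congr (Equiv.subtypeEquiv (Equiv.inv _) fun σ => ?_)
  rw [Equiv.inv_apply, inv_inv]
  exact and_comm

/-! ### Stirling numbers: limits and uniform bounds of the weights -/

theorem coeff_ascPochhammer_top (n : ℕ) : (ascPochhammer ℕ n).coeff n = 1 := by
  have h := monic_ascPochhammer ℕ n
  rwa [Polynomial.Monic, Polynomial.leadingCoeff, ascPochhammer_natDegree] at h

theorem coeff_ascPochhammer_succ {n m : ℕ} (hm : m < n) :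
    (ascPochhammer ℕ (n + 1)).coeff (n - m) =
      (ascPochhammer ℕ n).coeff (n - (m + 1)) + n * (ascPochhammer ℕ n).coeff (n - m) := by
  obtain ⟨k, hk⟩ : ∃ k, n - m = k + 1 := ⟨n - m - 1, by omega⟩
  rw [show n - (m + 1) = k by omega, hk, ascPochhammer_succ_right, mul_add, Polynomial.coeff_add,
    Polynomial.coeff_mul_X, ← Polynomial.C_eq_natCast, Polynomial.coeff_mul_C, mul_comm, Nat.cast_id]

theorem coeff_ascPochhammer_zero {n : ℕ} (hn : n ≠ 0) : (ascPochhammer ℕ n).coeff 0 = 0 := by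
  rw [Polynomial.coeff_zero_eq_eval_zero, ascPochhammer_ne_zero_eval_zero ℕ hn]

/-- Induction on the Stirling recurrence; the step is Bernoulli's inequality for `(n ^ 2 + 2 * n) ^
(m + 1)`, bounded by `((n + 1) ^ 2) ^ (m + 1)`. Together with the lower bound below this gives the
growth `(n ^ 2 / 2) ^ m / m!` for fixed `m`. -/
theorem coeff_ascPochhammer_le (n m : ℕ) (hm : m ≤ n) :
    ((ascPochhammer ℕ n).coeff (n - m) : ℝ) ≤ ((n : ℝ) ^ 2) ^ m / (2 ^ m * m.factorial) := by
  induction n generalizing m with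
  | zero =>
    obtain rfl : m = 0 := by omega
    simp
  | succ n ih =>
    rcases m with _ | m
    · simp [coeff_ascPochhammer_top]
    rcases hm.lt_or_eq with hm | hm
    · have h1 := ih m (by omega)
      have h2 := ih (m + 1) (by omega)
      rw [Nat.add_sub_add_right, coeff_ascPochhammer_succ (by omega)]
      push_cast
      refine (add_le_add h2 (mul_le_mul_of_nonneg_left h1 (Nat.cast_nonneg n))).trans ?_
      rw [Nat.factorial_succ]
      have h3 : (n : ℝ) ^ 2 * ((n : ℝ) ^ 2) ^ m + (m + 1) * (2 * n) * ((n : ℝ) ^ 2) ^ m ≤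
          (((n : ℝ) + 1) ^ 2) ^ (m + 1) := by
        have h4 : ((n : ℝ) ^ 2 + 2 * n) ^ (m + 1) ≤ (((n : ℝ) + 1) ^ 2) ^ (m + 1) := by
          gcongr; nlinarith
        have h5 : ((n : ℝ) ^ 2) ^ (m + 1) + ((m + 1 : ℕ) : ℝ) * ((n : ℝ) ^ 2) ^ (m + 1 - 1) * (2 * n) ≤
            ((n : ℝ) ^ 2 + 2 * n) ^ (m + 1) := by
          exact pow_add_mul_le_add_pow (by positivity) (by positivity) (m + 1)
        refine le_trans (le_of_eq ?_) (h5.trans h4)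
        push_cast
        ring
      push_cast
      rw [← sub_nonneg] at h3 ⊢
      have h8 : (0 : ℝ) < 2 ^ (m + 1) * ((m + 1) * m.factorial) := by positivity
      refine le_of_le_of_eq (div_nonneg h3 h8.le) ?_
      field_simp
      ring
    · rw [← hm, Nat.sub_self, hm, coeff_ascPochhammer_zero (by omega)]
      simp only [Nat.cast_zero]
      positivity

theorem le_coeff_ascPochhammer (n m : ℕ) (hm : m ≤ n) :
    ((n - m : ℝ) ^ 2) ^ m / (2 ^ m * m.factorial) ≤ ((ascPochhammer ℕ n).coeff (n - m) : ℝ) := by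
  induction n generalizing m with
  | zero =>
    obtain rfl : m = 0 := by omega
    simp
  | succ n ih =>
    rcases m with _ | m
    · simp [coeff_ascPochhammer_top]
    rcases hm.lt_or_eq with hm | hm
    · have h1 := ih m (by omega)
      have h2 := ih (m + 1) (by omega)
      rw [Nat.add_sub_add_right, coeff_ascPochhammer_succ (by omega)]
      push_cast at h2 ⊢
      refine le_trans ?_ (add_le_add h2 (mul_le_mul_of_nonneg_left h1 (Nat.cast_nonneg n)))
      rw [Nat.factorial_succ]
      obtain ⟨k, rfl⟩ : ∃ k, n = m + 1 + k := ⟨n - (m + 1), by omega⟩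
      push_cast
      have h3 : (((k : ℝ) + 1) ^ 2) ^ (m + 1) ≤ ((k : ℝ) ^ 2) ^ (m + 1) +
          (m + 1) * (2 * (m + 1 + k)) * (((k : ℝ) + 1) ^ 2) ^ m := by
        have h4 : (((k : ℝ) + 1) ^ 2) ^ (m + 1) - ((k : ℝ) ^ 2) ^ (m + 1) ≤
            (m + 1 : ℕ) * ((((k : ℝ) + 1) ^ 2) ^ (m + 1 - 1)) * (((k : ℝ) + 1) ^ 2 - (k : ℝ) ^ 2) := by
          have := pow_add_mul_le_add_pow (a := ((k : ℝ) + 1) ^ 2) (b := (k : ℝ) ^ 2 - ((k : ℝ) + 1) ^ 2)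
            (by positivity) (by nlinarith) (m + 1)
          rw [add_sub_cancel] at this
          linarith
        have h5 : (((k : ℝ) + 1) ^ 2 - (k : ℝ) ^ 2) ≤ 2 * (m + 1 + k) := by nlinarith
        have h6 : (m + 1 : ℕ) * ((((k : ℝ) + 1) ^ 2) ^ (m + 1 - 1)) *
            (((k : ℝ) + 1) ^ 2 - (k : ℝ) ^ 2) ≤
            (m + 1 : ℕ) * ((((k : ℝ) + 1) ^ 2) ^ (m + 1 - 1)) * (2 * (m + 1 + k)) := by gcongr
        have h7 := h4.trans h6
        push_cast at h7
        linarith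
      rw [← sub_nonneg] at h3 ⊢
      have h8 : (0 : ℝ) < 2 ^ (m + 1) * ((m + 1) * m.factorial) := by positivity
      refine le_of_le_of_eq (div_nonneg h3 h8.le) ?_
      rw [show (m : ℝ) + 1 + k - m = k + 1 by ring, show (m : ℝ) + 1 + k + 1 - (m + 1) = k + 1 by ring,
        show (m : ℝ) + 1 + k - (m + 1) = k by ring]
      field_simp
      ring
    · rw [← hm]
      simp

/-- Factor by factor, `n * (m - i) ≤ m * (n - i)`; then `m ^ m / m! ≤ exp m`. This holds uniformly
up to `m = n`, as domination of the sum over `m` requires. -/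
theorem pow_le_exp_mul_descFactorial {n m : ℕ} (hm : m ≤ n) :
    (n : ℝ) ^ m ≤ Real.exp m * n.descFactorial m := by
  have h1 : n ^ m * m.factorial ≤ m ^ m * n.descFactorial m := by
    rw [← Nat.descFactorial_self m, Nat.descFactorial_eq_prod_range,
      Nat.descFactorial_eq_prod_range, Finset.pow_eq_prod_const, Finset.pow_eq_prod_const,
      ← Finset.prod_mul_distrib, ← Finset.prod_mul_distrib]
    refine Finset.prod_le_prod' fun i _ => ?_
    rw [Nat.mul_sub, Nat.mul_sub, mul_comm m n]
    have : m * i ≤ n * i := Nat.mul_le_mul_right i hm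
    omega
  have h2 := Real.pow_div_factorial_le_exp (m : ℝ) (Nat.cast_nonneg m) m
  have h3 : (0 : ℝ) < m.factorial := by positivity
  rw [div_le_iff₀ h3] at h2
  have h4 : (n : ℝ) ^ m * m.factorial ≤ (m : ℝ) ^ m * n.descFactorial m := by exact_mod_cast h1
  have h5 : (m : ℝ) ^ m * n.descFactorial m ≤ Real.exp m * m.factorial * n.descFactorial m := by
    gcongr
  have h6 := h4.trans h5
  refine le_of_mul_le_mul_right (h6.trans_eq ?_) h3
  ring

theorem stirlingWeight_eq {n m : ℕ} (hn : n ≠ 0) (hm : m ≤ n) :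
    stirlingWeight n m = (ascPochhammer ℕ n).coeff (n - m) / ((n : ℝ) ^ 2) ^ m *
      ((n : ℝ) ^ m / n.descFactorial m) ^ 2 := by
  have h1 := Nat.factorial_mul_descFactorial hm
  have h2 : ((n - m).factorial : ℝ) * n.descFactorial m = n.factorial := by exact_mod_cast h1
  have h3 : ((n - m).factorial : ℝ) ≠ 0 := by positivity
  have h4 : (n.factorial : ℝ) ≠ 0 := by positivity
  have h5 : (n.descFactorial m : ℝ) ≠ 0 := fun h => h4 (by rw [← h2, h, mul_zero])
  have h6 : (n : ℝ) ≠ 0 := by exact_mod_cast hn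
  rw [stirlingWeight, ← h2, ← pow_mul, div_pow, div_pow, ← pow_mul, mul_comm m 2]
  field_simp

theorem stirlingWeight_nonneg (n m : ℕ) : 0 ≤ stirlingWeight n m := by
  unfold stirlingWeight
  positivity

theorem stirlingWeight_le {n m : ℕ} (hn : n ≠ 0) (hm : m ≤ n) :
    stirlingWeight n m ≤ (Real.exp 2 / 2) ^ m / m.factorial := by
  have hn' : (0 : ℝ) < n := by exact_mod_cast Nat.pos_of_ne_zero hn
  have h0 : (0 : ℝ) < n.descFactorial m := by
    exact_mod_cast Nat.pos_of_ne_zero fun h => by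
      rw [Nat.descFactorial_eq_zero_iff_lt] at h; omega
  have h1 : ((ascPochhammer ℕ n).coeff (n - m) : ℝ) / ((n : ℝ) ^ 2) ^ m ≤
      1 / (2 ^ m * m.factorial) := by
    rw [div_le_iff₀ (by positivity)]
    refine (coeff_ascPochhammer_le n m hm).trans_eq ?_
    ring
  have h2 : (n : ℝ) ^ m / n.descFactorial m ≤ Real.exp m := by
    rw [div_le_iff₀ h0]
    exact pow_le_exp_mul_descFactorial hm
  rw [stirlingWeight_eq hn hm]
  calc _ ≤ 1 / (2 ^ m * m.factorial) * Real.exp m ^ 2 := by gcongr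
    _ = _ := by
      rw [div_pow, ← Real.exp_nat_mul, ← Real.exp_nat_mul]
      rw [show ((2 : ℕ) : ℝ) * m = m * 2 by push_cast; ring]
      field_simp

theorem tendsto_sub_div_natCast (m : ℕ) :
    Tendsto (fun n : ℕ => ((n : ℝ) - m) / n) atTop (nhds 1) := by
  have h : Tendsto (fun n : ℕ => 1 - (m : ℝ) / n) atTop (nhds (1 - 0)) :=
    tendsto_const_nhds.sub (tendsto_const_div_atTop_nhds_zero_nat (m : ℝ))
  rw [sub_zero] at h
  refine h.congr' ?_
  filter_upwards [eventually_gt_atTop 0] with n hn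
  have : (n : ℝ) ≠ 0 := by exact_mod_cast hn.ne'
  field_simp

theorem tendsto_stirlingWeight (m : ℕ) :
    Tendsto (fun n => stirlingWeight n m) atTop (nhds (1 / (2 ^ m * m.factorial))) := by
  have h1 : Tendsto (fun n : ℕ => ((ascPochhammer ℕ n).coeff (n - m) : ℝ) / ((n : ℝ) ^ 2) ^ m)
      atTop (nhds (1 / (2 ^ m * m.factorial))) := by
    have h2 : Tendsto (fun n : ℕ => ((((n : ℝ) - m) / n) ^ 2) ^ m * (1 / (2 ^ m * m.factorial)))
        atTop (nhds (((1 : ℝ) ^ 2) ^ m * (1 / (2 ^ m * m.factorial)))) :=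
      (((tendsto_sub_div_natCast m).pow 2).pow m).mul_const _
    rw [one_pow, one_pow, one_mul] at h2
    refine tendsto_of_tendsto_of_tendsto_of_le_of_le' h2 tendsto_const_nhds ?_ ?_
    · filter_upwards [eventually_gt_atTop 0, eventually_ge_atTop m] with n hn hm
      have hn' : (0 : ℝ) < n := by exact_mod_cast hn
      rw [le_div_iff₀ (by positivity)]
      refine le_trans (le_of_eq ?_) (le_coeff_ascPochhammer n m hm)
      rw [div_pow, div_pow]
      field_simp
    · filter_upwards [eventually_gt_atTop 0, eventually_ge_atTop m] with n hn hm
      have hn' : (0 : ℝ) < n := by exact_mod_cast hn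
      rw [div_le_iff₀ (by positivity)]
      refine (coeff_ascPochhammer_le n m hm).trans_eq ?_
      ring
  have h3 : Tendsto (fun n : ℕ => (n : ℝ) ^ m / n.descFactorial m) atTop (nhds 1) := by
    have h4 : Tendsto (fun n : ℕ => ((((n : ℝ) - m) / n) ^ m)⁻¹) atTop (nhds ((1 : ℝ) ^ m)⁻¹) :=
      ((tendsto_sub_div_natCast m).pow m).inv₀ (by simp)
    rw [one_pow, inv_one] at h4
    refine tendsto_of_tendsto_of_tendsto_of_le_of_le' tendsto_const_nhds h4 ?_ ?_
    · filter_upwards [eventually_ge_atTop m] with n hm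
      have h0 : (0 : ℝ) < n.descFactorial m := by
        exact_mod_cast Nat.pos_of_ne_zero fun h => by
          rw [Nat.descFactorial_eq_zero_iff_lt] at h; omega
      rw [le_div_iff₀ h0, one_mul]
      exact_mod_cast Nat.descFactorial_le_pow n m
    · filter_upwards [eventually_gt_atTop m] with n hm
      have h0 : (0 : ℝ) < (n : ℝ) - m := by rw [sub_pos]; exact_mod_cast hm
      rw [div_pow, inv_div]
      have h5 : ((n : ℝ) - m) ^ m ≤ n.descFactorial m := by
        have h6 := Nat.pow_sub_le_descFactorial n m
        have h7 : ((n : ℝ) - m) ^ m ≤ ((n + 1 - m : ℕ) : ℝ) ^ m := by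
          gcongr
          rw [Nat.cast_sub (by omega)]
          push_cast
          linarith
        exact h7.trans (by exact_mod_cast h6)
      gcongr
  have h := h1.mul (h3.pow 2)
  rw [one_pow, mul_one] at h
  refine h.congr' ?_
  filter_upwards [eventually_gt_atTop 0, eventually_ge_atTop m] with n hn hm
  rw [stirlingWeight_eq hn.ne' hm]

/-! ### Laplace inversion -/

theorem integrableOn_pow_mul_exp_neg_mul {t : ℝ} (ht : 0 < t) (N : ℕ) :
    IntegrableOn (fun x : ℝ => x ^ N * Real.exp (-t * x)) (Set.Ioi 0) := by
  refine integrable_of_isBigO_exp_neg (b := t / 2) (by positivity) (by fun_prop) ?_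
  have h := (isLittleO_pow_exp_pos_mul_atTop N (half_pos ht)).isBigO
  refine (h.mul (isBigO_refl (fun x : ℝ => Real.exp (-t * x)) atTop)).congr_right fun x => ?_
  rw [← Real.exp_add]
  ring_nf

theorem integrableOn_pow_mul_cexp_neg_mul {z : ℂ} (hz : 0 < z.re) (N : ℕ) :
    IntegrableOn (fun x : ℝ => (x : ℂ) ^ N * Complex.exp (-z * x)) (Set.Ioi 0) := by
  refine (integrable_norm_iff (by fun_prop)).1 ?_
  refine (integrableOn_pow_mul_exp_neg_mul hz N).congr_fun (fun x hx => ?_) measurableSet_Ioi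
  simp [Complex.norm_exp, abs_of_pos (Set.mem_Ioi.1 hx)]

theorem integral_pow_mul_cexp_neg_mul {z : ℂ} (hz : 0 < z.re) (N : ℕ) :
    ∫ x : ℝ in Set.Ioi 0, (x : ℂ) ^ N * Complex.exp (-z * x) = N.factorial / z ^ (N + 1) := by
  have hz0 : z ≠ 0 := fun h => by simp [h] at hz
  induction N with
  | zero =>
    have := integral_exp_mul_complex_Ioi (a := -z) (by simpa using hz) 0
    simpa using this
  | succ N ih =>
    have h1 : ∫ x : ℝ in Set.Ioi 0, (((N : ℂ) + 1) * ((x : ℂ) ^ N * Complex.exp (-z * x)) -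
        z * ((x : ℂ) ^ (N + 1) * Complex.exp (-z * x))) = 0 - ((0 : ℝ) : ℂ) ^ (N + 1) *
          Complex.exp (-z * (0 : ℝ)) := by
      refine integral_Ioi_of_hasDerivAt_of_tendsto'
        (f := fun x : ℝ => (x : ℂ) ^ (N + 1) * Complex.exp (-z * x)) (fun x _ => ?_) ?_ ?_
      · have h2 := (hasDerivAt_pow (N + 1) (x : ℂ)).mul
            (((hasDerivAt_id (x : ℂ)).const_mul (-z)).cexp)
        refine (h2.congr_deriv ?_).comp_ofReal
        simp only [id, Nat.cast_add, Nat.cast_one, Nat.add_sub_cancel]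
        ring
      · exact ((integrableOn_pow_mul_cexp_neg_mul hz N).const_mul _).sub
          ((integrableOn_pow_mul_cexp_neg_mul hz (N + 1)).const_mul _)
      · rw [tendsto_zero_iff_norm_tendsto_zero]
        have h3 := (isLittleO_pow_exp_pos_mul_atTop (N + 1) hz).tendsto_div_nhds_zero
        refine h3.congr' ?_
        filter_upwards [eventually_gt_atTop 0] with x hx
        simp [Complex.norm_exp, abs_of_pos hx, Real.exp_neg, div_eq_mul_inv]
    rw [integral_sub ((integrableOn_pow_mul_cexp_neg_mul hz N).const_mul _)
      ((integrableOn_pow_mul_cexp_neg_mul hz (N + 1)).const_mul _), integral_const_mul,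
      integral_const_mul, ih] at h1
    simp only [Complex.ofReal_zero, ne_eq, Nat.succ_ne_zero, not_false_eq_true, zero_pow, zero_mul,
      sub_zero] at h1
    rw [sub_eq_zero] at h1
    rw [← mul_right_inj' hz0, ← h1, Nat.factorial_succ]
    push_cast
    field_simp
    ring

theorem re_add_mul_I (t v : ℝ) : ((t : ℂ) + v * Complex.I).re = t := by simp

theorem sq_norm_add_mul_I (t v : ℝ) : ‖(t : ℂ) + v * Complex.I‖ ^ 2 = t ^ 2 + v ^ 2 := by
  rw [← Complex.normSq_eq_norm_sq, Complex.normSq_add_mul_I]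

theorem add_mul_I_ne_zero {t : ℝ} (ht : 0 < t) (v : ℝ) : (t : ℂ) + v * Complex.I ≠ 0 := fun h => by
  have := congrArg Complex.re h
  simp at this
  exact ht.ne' this

theorem le_norm_add_mul_I {t : ℝ} (ht : 0 < t) (v : ℝ) : t ≤ ‖(t : ℂ) + v * Complex.I‖ := by
  have := Complex.abs_re_le_norm ((t : ℂ) + v * Complex.I)
  rwa [re_add_mul_I, abs_of_pos ht] at this

theorem integrable_inv_sq_norm_add_mul_I {t : ℝ} (ht : 0 < t) :
    Integrable fun v : ℝ => (‖(t : ℂ) + v * Complex.I‖ ^ 2)⁻¹ := by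
  have h := (integrable_inv_one_add_sq.comp_div ht.ne').const_mul (t ^ 2)⁻¹
  refine h.congr (ae_of_all _ fun v => ?_)
  simp only
  rw [sq_norm_add_mul_I, ← mul_inv]
  congr 1
  field_simp

theorem integrable_inv_pow_add_mul_I {t : ℝ} (ht : 0 < t) {N : ℕ} (hN : N ≠ 0) :
    Integrable fun v : ℝ => (((t : ℂ) + v * Complex.I) ^ (N + 1))⁻¹ := by
  refine ((integrable_inv_sq_norm_add_mul_I ht).const_mul (t ^ (N - 1))⁻¹).mono' ?_ ?_
  · refine Continuous.aestronglyMeasurable (Continuous.inv₀ (by fun_prop) fun v => ?_)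
    exact pow_ne_zero _ (add_mul_I_ne_zero ht v)
  · refine ae_of_all _ fun v => ?_
    obtain ⟨M, rfl⟩ := Nat.exists_eq_succ_of_ne_zero hN
    rw [norm_inv, norm_pow, ← mul_inv]
    have h := le_norm_add_mul_I ht v
    have h' : (0 : ℝ) < ‖(t : ℂ) + v * Complex.I‖ := ht.trans_le h
    refine inv_anti₀ (by positivity) ?_
    rw [show M.succ + 1 = (M.succ - 1) + 2 by simp, pow_add]
    gcongr

theorem continuous_truncPow (N : ℕ) : Continuous (truncPow N) := by
  unfold truncPow
  fun_prop

/-- Laplace inversion for truncated powers. -/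
theorem truncPow_eq_integral {t : ℝ} (ht : 0 < t) {N : ℕ} (hN : N ≠ 0) (x : ℝ) :
    (truncPow N x : ℂ) = 1 / (2 * Real.pi) * ∫ v : ℝ,
      Complex.exp (((t : ℂ) + v * Complex.I) * x) * (((t : ℂ) + v * Complex.I) ^ (N + 1))⁻¹ := by
  -- The damped function has Fourier transform `(t + 2πiw) ^ (-(N + 1))`, integrable because `N ≠
  -- 0`, so Fourier inversion applies pointwise; then `v = 2πw`.
  set f : ℝ → ℂ := fun x => (truncPow N x : ℂ) * Complex.exp (-t * x) with hf
  have hfc : Continuous f := by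
    have := continuous_truncPow N
    rw [hf]; fun_prop
  have hind : ∀ z : ℂ, (fun x : ℝ => (truncPow N x : ℂ) * Complex.exp (-z * x)) =
      (Set.Ioi 0).indicator fun x : ℝ => (N.factorial : ℂ)⁻¹ * ((x : ℂ) ^ N * Complex.exp (-z * x)) := by
    intro z
    ext x
    by_cases hx : x ∈ Set.Ioi (0 : ℝ)
    · rw [Set.indicator_of_mem hx, truncPow, max_eq_left (Set.mem_Ioi.1 hx).le]
      push_cast
      ring
    · rw [Set.indicator_of_notMem hx, truncPow_of_nonpos hN (by simpa using hx)]
      simp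
  have hfi : Integrable f := by
    rw [hf, hind, integrable_indicator_iff measurableSet_Ioi]
    exact (integrableOn_pow_mul_cexp_neg_mul (by simpa using ht) N).const_mul _
  have hF : FourierTransform.fourier f = fun w : ℝ =>
      (((t : ℂ) + (w * (2 * Real.pi) : ℝ) * Complex.I) ^ (N + 1))⁻¹ := by
    ext w
    rw [Real.fourier_real_eq_integral_exp_smul]
    set z : ℂ := (t : ℂ) + (w * (2 * Real.pi) : ℝ) * Complex.I with hz
    have hz' : 0 < z.re := by rw [hz, re_add_mul_I]; exact ht
    have h1 : (fun v : ℝ => Complex.exp (↑(-2 * Real.pi * v * w) * Complex.I) • f v) =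
        fun v : ℝ => (truncPow N v : ℂ) * Complex.exp (-z * v) := by
      ext v
      rw [hf, smul_eq_mul, mul_left_comm, ← Complex.exp_add, hz]
      congr 2
      push_cast
      ring
    rw [h1, hind, integral_indicator measurableSet_Ioi, integral_const_mul,
      integral_pow_mul_cexp_neg_mul hz' N]
    have : (N.factorial : ℂ) ≠ 0 := by exact_mod_cast N.factorial_ne_zero
    field_simp
  have hFi : Integrable (FourierTransform.fourier f) := by
    rw [hF]
    exact (integrable_inv_pow_add_mul_I ht hN).comp_mul_right' (by positivity)
  have h := congrFun (hfc.fourierInv_fourier_eq hfi hFi) x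
  rw [Real.fourierInv_eq', hF] at h
  have h2 : (truncPow N x : ℂ) = Complex.exp (t * x) * f x := by
    rw [hf, mul_left_comm, ← Complex.exp_add]
    simp
  rw [h2, ← h, ← integral_const_mul]
  have h3 := Measure.integral_comp_mul_right (fun v : ℝ =>
    Complex.exp (((t : ℂ) + v * Complex.I) * x) * (((t : ℂ) + v * Complex.I) ^ (N + 1))⁻¹)
    (2 * Real.pi)
  have h4 : |(2 * Real.pi)⁻¹| = (2 * Real.pi)⁻¹ := abs_of_pos (by positivity)
  rw [h4, Complex.real_smul] at h3
  push_cast at h3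
  rw [one_div, ← h3]
  congr 1
  ext v
  rw [smul_eq_mul, ← mul_assoc, ← Complex.exp_add]
  push_cast
  congr 2
  simp
  ring

theorem integrable_cexp_mul_inv_pow_add_mul_I {t : ℝ} (ht : 0 < t) {N : ℕ} (hN : N ≠ 0) (x : ℝ) :
    Integrable fun v : ℝ =>
      Complex.exp (((t : ℂ) + v * Complex.I) * x) * (((t : ℂ) + v * Complex.I) ^ (N + 1))⁻¹ := by
  refine (integrable_inv_pow_add_mul_I ht hN).bdd_mul (c := Real.exp (t * x))
    (Continuous.aestronglyMeasurable (by fun_prop)) (ae_of_all _ fun v => ?_)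
  rw [Complex.norm_exp]
  simp

theorem splineDiff_eq_integral {t : ℝ} (ht : 0 < t) {n m : ℕ} (hm : m < n) (a : ℤ) :
    (splineDiff n m a : ℂ) = 1 / (2 * Real.pi) * ∫ v : ℝ,
      Complex.exp (((t : ℂ) + v * Complex.I) * a) *
        (1 - Complex.exp (-((t : ℂ) + v * Complex.I))) ^ n *
        (((t : ℂ) + v * Complex.I) ^ (n - m + 1))⁻¹ := by
  have hN : n - m ≠ 0 := by omega
  rw [splineDiff, bwdDiff]
  push_cast
  have h1 : ∀ r : ℕ, (truncPow (n - m) (a - r) : ℂ) = 1 / (2 * Real.pi) * ∫ v : ℝ,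
      Complex.exp (((t : ℂ) + v * Complex.I) * (a - r : ℝ)) *
        (((t : ℂ) + v * Complex.I) ^ (n - m + 1))⁻¹ := fun r =>
    truncPow_eq_integral ht hN _
  simp only [h1]
  simp only [mul_left_comm _ (1 / (2 * (Real.pi : ℂ))), ← integral_const_mul]
  rw [← integral_finsetSum _ fun r _ =>
    ((integrable_cexp_mul_inv_pow_add_mul_I ht hN _).const_mul _).const_mul _]
  congr 1
  ext v
  set z : ℂ := (t : ℂ) + v * Complex.I
  -- The alternating binomial sum of the shifts `exp (-r * z)` is `(1 - exp (-z)) ^ n`.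
  rw [sub_eq_neg_add, add_pow (-Complex.exp (-z)), Finset.mul_sum, Finset.sum_mul,
    Finset.mul_sum]
  refine Finset.sum_congr rfl fun r _ => ?_
  rw [neg_pow (Complex.exp _), ← Complex.exp_nat_mul, one_pow]
  rw [show z * ((a - r : ℝ) : ℂ) = z * a + r * (-z) by push_cast; ring, Complex.exp_add]
  ring

/-! ### The characteristic function of the tilted uniform law -/

noncomputable section

/-- The characteristic function at `v` of the uniform law on `[-x, 1 - x]` exponentially tilted by
`t`. -/
def tiltedChar (t x v : ℝ) : ℂ :=
  (t / (1 - Real.exp (-t)) : ℝ) * (Complex.exp ((1 - x) * v * Complex.I) *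
    (1 - Complex.exp (-((t : ℂ) + v * Complex.I))) / ((t : ℂ) + v * Complex.I))

/-- The function `exp (-t) / (1 - exp (-t)) ^ 2`. -/
def expRatio (t : ℝ) : ℝ := Real.exp (-t) / (1 - Real.exp (-t)) ^ 2

end

theorem one_sub_exp_neg_pos {t : ℝ} (ht : 0 < t) : 0 < 1 - Real.exp (-t) := by
  rw [sub_pos, Real.exp_lt_one_iff]
  linarith

theorem expRatio_pos {t : ℝ} (ht : 0 < t) : 0 < expRatio t := by
  have := one_sub_exp_neg_pos ht
  unfold expRatio
  positivity

theorem sq_norm_one_sub_cexp (t v : ℝ) :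
    ‖1 - Complex.exp (-((t : ℂ) + v * Complex.I))‖ ^ 2 =
      (1 - Real.exp (-t)) ^ 2 + Real.exp (-t) * (2 * (1 - Real.cos v)) := by
  rw [← Complex.normSq_eq_norm_sq, Complex.normSq_apply]
  simp only [Complex.sub_re, Complex.one_re, Complex.sub_im, Complex.one_im, Complex.exp_re,
    Complex.exp_im, Complex.neg_re, Complex.neg_im, Complex.add_re, Complex.add_im,
    Complex.ofReal_re, Complex.ofReal_im, Complex.mul_re, Complex.mul_im, Complex.I_re,
    Complex.I_im, mul_zero, mul_one, sub_zero, zero_add, add_zero, Real.cos_neg, Real.sin_neg]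
  linear_combination (Real.exp (-t)) ^ 2 * Real.sin_sq_add_cos_sq v

theorem sq_norm_tiltedChar {t : ℝ} (ht : 0 < t) (x v : ℝ) :
    ‖tiltedChar t x v‖ ^ 2 = (1 + expRatio t * (2 * (1 - Real.cos v))) / (1 + v ^ 2 / t ^ 2) := by
  have h1 := one_sub_exp_neg_pos ht
  have h2 : ‖Complex.exp ((1 - x) * v * Complex.I)‖ = 1 := by
    rw [Complex.norm_exp]; simp
  rw [tiltedChar, norm_mul, norm_div, norm_mul, h2, one_mul, mul_pow, div_pow,
    sq_norm_one_sub_cexp, sq_norm_add_mul_I, Complex.norm_real, Real.norm_eq_abs, sq_abs, expRatio]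
  field_simp

theorem two_mul_one_sub_cos_le_sq (v : ℝ) : 2 * (1 - Real.cos v) ≤ v ^ 2 := by
  have := Real.one_sub_sq_div_two_le_cos (x := v)
  linarith

/-- With `k = expRatio t`, `w = 2 * (1 - cos v)` and `c = s / (1 + 4 * k)`, it suffices that `(1 + k
w)(1 + c v²) ≤ 1 + (s + k) v²`. Use `w ≤ v²` in the term `k w` and `w ≤ 4` in the product term; this
fixes the constant `c`. -/
theorem sq_norm_tiltedChar_le {t s : ℝ} (ht : 0 < t) (hs : s = 1 / t ^ 2 - expRatio t)
    (hs0 : 0 < s) (x v : ℝ) :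
    ‖tiltedChar t x v‖ ^ 2 ≤ 1 / (1 + s / (1 + 4 * expRatio t) * v ^ 2) := by
  have hk := expRatio_pos ht
  set k := expRatio t
  have h1 := two_mul_one_sub_cos_le_sq v
  have h2 : 2 * (1 - Real.cos v) ≤ 4 := by linarith [Real.neg_one_le_cos v]
  have h3 : 0 ≤ 2 * (1 - Real.cos v) := by linarith [Real.cos_le_one v]
  rw [sq_norm_tiltedChar ht, div_le_div_iff₀ (by positivity) (by positivity)]
  set w := 2 * (1 - Real.cos v)
  set c := s / (1 + 4 * k)
  have hc : 0 < c := by positivity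
  have h4 : c * (1 + 4 * k) = s := by simp only [c]; field_simp
  have h5 : v ^ 2 / t ^ 2 = (s + k) * v ^ 2 := by rw [hs]; ring
  rw [h5, ← h4]
  have h6 : k * w ≤ k * v ^ 2 := by gcongr
  have h7 : k * w * (c * v ^ 2) ≤ k * 4 * (c * v ^ 2) := by gcongr
  nlinarith

/-- The binomial expansion to second order suffices, since `n ^ 2 / 4 ≤ n * (n - 1) / 2` once `n ≥
2`. The square compensates for the bound being on the squared norm. -/
theorem one_add_half_sq_le_pow {n : ℕ} (hn : 2 ≤ n) {s : ℝ} (hs : 0 ≤ s) :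
    (1 + n * s / 2) ^ 2 ≤ (1 + s) ^ n := by
  have h : ∀ n : ℕ, 1 + n * s + n * (n - 1) / 2 * s ^ 2 ≤ (1 + s) ^ n := by
    intro n
    induction n with
    | zero => simp
    | succ n ih =>
      rw [pow_succ]
      refine le_trans ?_ (mul_le_mul_of_nonneg_right ih (by linarith))
      have : 0 ≤ (n : ℝ) * (n - 1) / 2 * s ^ 3 := by
        rcases n with _ | n
        · simp
        · push_cast
          rw [add_sub_cancel_right]
          positivity
      push_cast
      nlinarith
  refine le_trans ?_ (h n)
  have h2 : (2 : ℝ) ≤ n := by exact_mod_cast hn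
  have h3 : 0 ≤ s ^ 2 * (n * (n - 2)) := by
    have : (0 : ℝ) ≤ n - 2 := by linarith
    positivity
  nlinarith

theorem norm_tiltedChar_pow_le {t s : ℝ} (ht : 0 < t) (hs : s = 1 / t ^ 2 - expRatio t)
    (hs0 : 0 < s) (x v : ℝ) {n : ℕ} (hn : 2 ≤ n) :
    ‖tiltedChar t x v‖ ^ n ≤ (1 + n * (s / (1 + 4 * expRatio t)) * v ^ 2 / 2)⁻¹ := by
  have hk := expRatio_pos ht
  set c := s / (1 + 4 * expRatio t)
  have hc : 0 < c := by positivity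
  refine le_of_sq_le_sq ?_ (by positivity)
  rw [inv_pow, ← pow_mul, mul_comm n 2, pow_mul]
  calc (‖tiltedChar t x v‖ ^ 2) ^ n ≤ (1 / (1 + c * v ^ 2)) ^ n := by
        gcongr; exact sq_norm_tiltedChar_le ht hs hs0 x v
    _ = ((1 + c * v ^ 2) ^ n)⁻¹ := by rw [one_div, inv_pow]
    _ ≤ _ := by
      have := one_add_half_sq_le_pow hn (s := c * v ^ 2) (by positivity)
      rw [← mul_assoc] at this
      gcongr

theorem continuous_tiltedChar {t : ℝ} (ht : 0 < t) (x : ℝ) : Continuous (tiltedChar t x) := by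
  unfold tiltedChar
  refine continuous_const.mul (Continuous.div (by fun_prop) (by fun_prop) fun v =>
    add_mul_I_ne_zero ht v)

/-- Each of the `m` extra factors `z` in the saddle integrand is absorbed by one characteristic
function, at the cost of a constant. -/
theorem norm_mul_tiltedChar_le {t : ℝ} (ht : 0 < t) (x v : ℝ) :
    ‖(t : ℂ) + v * Complex.I‖ * ‖tiltedChar t x v‖ ≤ 2 * t / (1 - Real.exp (-t)) := by
  have h1 := one_sub_exp_neg_pos ht
  have h2 : ‖Complex.exp ((1 - x) * v * Complex.I)‖ = 1 := by
    rw [Complex.norm_exp]; simp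
  have h3 : ‖1 - Complex.exp (-((t : ℂ) + v * Complex.I))‖ ≤ 2 := by
    refine (norm_sub_le _ _).trans ?_
    rw [norm_one, Complex.norm_exp]
    have : Real.exp (-t) ≤ 1 := by linarith
    simp only [Complex.neg_re, re_add_mul_I]
    linarith
  have h4 : 0 < ‖(t : ℂ) + v * Complex.I‖ := ht.trans_le (le_norm_add_mul_I ht v)
  rw [tiltedChar, norm_mul, norm_div, norm_mul, h2, one_mul, Complex.norm_real, Real.norm_eq_abs,
    abs_of_pos (by positivity)]
  calc _ = t / (1 - Real.exp (-t)) * ‖1 - Complex.exp (-((t : ℂ) + v * Complex.I))‖ := by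
        field_simp
    _ ≤ t / (1 - Real.exp (-t)) * 2 := by gcongr
    _ = _ := by ring

theorem one_sub_cexp_ne_zero {t : ℝ} (ht : 0 < t) (v : ℝ) :
    1 - Complex.exp (-((t : ℂ) + v * Complex.I)) ≠ 0 := fun h => by
  have h1 := sq_norm_one_sub_cexp t v
  have h2 := one_sub_exp_neg_pos ht
  have h3 : 0 ≤ 1 - Real.cos v := by linarith [Real.cos_le_one v]
  rw [h, norm_zero] at h1
  have : 0 < (1 - Real.exp (-t)) ^ 2 + Real.exp (-t) * (2 * (1 - Real.cos v)) := by positivity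
  rw [← h1] at this
  simp at this

theorem tiltedChar_zero {t : ℝ} (ht : 0 < t) (x : ℝ) : tiltedChar t x 0 = 1 := by
  have h1 := (one_sub_exp_neg_pos ht).ne'
  have h2 : (1 - Complex.exp (-t) : ℂ) ≠ 0 := by exact_mod_cast h1
  have h3 : (t : ℂ) ≠ 0 := by exact_mod_cast ht.ne'
  rw [tiltedChar]
  push_cast
  simp only [mul_zero, zero_mul, add_zero, Complex.exp_zero, one_mul]
  field_simp

theorem hasDerivAt_tiltedChar {t : ℝ} (ht : 0 < t) (x v : ℝ) :
    HasDerivAt (tiltedChar t x) (tiltedChar t x v * (Complex.I * ((1 - x) +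
      (1 - Complex.exp (-((t : ℂ) + v * Complex.I)))⁻¹ - 1 - ((t : ℂ) + v * Complex.I)⁻¹))) v := by
  have hz : HasDerivAt (fun w : ℂ => (t : ℂ) + w * Complex.I) (1 * Complex.I) (v : ℂ) :=
    ((hasDerivAt_id (v : ℂ)).mul_const Complex.I).const_add _
  have hx : HasDerivAt (fun w : ℂ => (1 - x) * w * Complex.I) ((1 - x) * 1 * Complex.I) (v : ℂ) :=
    ((hasDerivAt_id (v : ℂ)).const_mul (1 - x : ℂ)).mul_const Complex.I
  have hne := add_mul_I_ne_zero ht v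
  have hne' := one_sub_cexp_ne_zero ht v
  have h := (((hx.cexp.mul (hz.neg.cexp.const_sub 1)).div hz hne).const_mul
    ((t / (1 - Real.exp (-t)) : ℝ) : ℂ)).comp_ofReal
  refine h.congr_deriv ?_
  rw [tiltedChar]
  simp only [Pi.neg_apply, Pi.mul_apply]
  field_simp
  ring

/-- The condition on `x` centres the law, so the logarithmic derivative `g` vanishes at `0`; its
slope there is `-s`, with `s` the variance. The first-order expansion of the derivative is then
integrated. -/
theorem tiltedChar_sub_isLittleO {t x s : ℝ} (ht : 0 < t)
    (hx : x = 1 / (1 - Real.exp (-t)) - 1 / t) (hs : s = 1 / t ^ 2 - expRatio t) :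
    (fun v : ℝ => tiltedChar t x v - (1 - s * v ^ 2 / 2)) =o[nhds 0] fun v : ℝ => v ^ 2 := by
  set g : ℝ → ℂ := fun v => Complex.I * ((1 - x) +
      (1 - Complex.exp (-((t : ℂ) + v * Complex.I)))⁻¹ - 1 - ((t : ℂ) + v * Complex.I)⁻¹) with hg
  have h1 := (one_sub_exp_neg_pos ht).ne'
  have h2 : (1 - Complex.exp (-t) : ℂ) ≠ 0 := by exact_mod_cast h1
  have h3 : (t : ℂ) ≠ 0 := by exact_mod_cast ht.ne'
  have hg0 : g 0 = 0 := by
    rw [hg, hx]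
    push_cast
    simp only [zero_mul, add_zero]
    field_simp
    ring
  have hgd : HasDerivAt g (-s : ℂ) 0 := by
    have hz : HasDerivAt (fun w : ℂ => (t : ℂ) + w * Complex.I) (1 * Complex.I) ((0 : ℝ) : ℂ) :=
      ((hasDerivAt_id _).mul_const Complex.I).const_add _
    have hne := add_mul_I_ne_zero ht 0
    have hne' := one_sub_cexp_ne_zero ht 0
    have h := (((((hz.neg.cexp.const_sub 1).inv hne').const_add (1 - x : ℂ)).sub_const 1).sub
      (hz.inv hne)).const_mul Complex.I |>.comp_ofReal
    refine h.congr_deriv ?_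
    rw [hs, expRatio]
    push_cast
    simp only [Pi.neg_apply, zero_mul, add_zero]
    field_simp
    ring_nf
    simp only [Complex.I_sq]
    ring
  have hprod : HasDerivAt (fun v => tiltedChar t x v * g v) (-s : ℂ) 0 := by
    have h := (hasDerivAt_tiltedChar ht x 0).mul hgd
    rw [tiltedChar_zero ht, hg0, mul_zero, one_mul, zero_add] at h
    exact h
  have hlit : (fun v : ℝ => (tiltedChar t x v * g v + s * v : ℂ)) =o[nhds 0]
      fun v : ℝ => (v - 0) ^ 1 := by
    have h := hprod.isLittleO
    simp only [hg0, mul_zero, sub_zero] at h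
    simp only [sub_zero, pow_one]
    refine h.congr_left fun v => ?_
    rw [Complex.real_smul]
    ring
  have hder : ∀ v : ℝ, HasDerivAt (fun v : ℝ => (tiltedChar t x v - (1 - s * v ^ 2 / 2) : ℂ))
      (tiltedChar t x v * g v + s * v : ℂ) v := by
    intro v
    have h4 : HasDerivAt (fun w : ℂ => (1 : ℂ) - s * w ^ 2 / 2) (-(s * v) : ℂ) (v : ℂ) := by
      have := (((hasDerivAt_pow 2 (v : ℂ)).const_mul (s : ℂ)).div_const 2).const_sub 1
      refine this.congr_deriv ?_
      push_cast
      ring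
    have h5 := (hasDerivAt_tiltedChar ht x v).sub h4.comp_ofReal
    refine h5.congr_deriv ?_
    rw [sub_neg_eq_add]
  have h := convex_univ.isLittleO_pow_succ_real (Set.mem_univ (0 : ℝ))
    (fun v _ => (hder v).hasDerivWithinAt) (by rwa [nhdsWithin_univ])
  rw [nhdsWithin_univ] at h
  simpa [tiltedChar_zero ht] using h

theorem tendsto_tiltedChar_pow {t x s : ℝ} (ht : 0 < t)
    (hx : x = 1 / (1 - Real.exp (-t)) - 1 / t) (hs : s = 1 / t ^ 2 - expRatio t) (u : ℝ) :
    Tendsto (fun n : ℕ => tiltedChar t x (u / Real.sqrt n) ^ n) atTop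
      (nhds (Complex.exp (-(s * u ^ 2 / 2)))) := by
  refine Complex.tendsto_pow_exp_of_isLittleO_sub_add_div _ ?_
  have h0 : Tendsto (fun n : ℕ => u / Real.sqrt n) atTop (nhds 0) :=
    tendsto_const_nhds.div_atTop (Real.tendsto_sqrt_atTop.comp tendsto_natCast_atTop_atTop)
  have h := (tiltedChar_sub_isLittleO ht hx hs).comp_tendsto h0
  have h1 : (fun n : ℕ => (u / Real.sqrt n) ^ 2) =O[atTop] fun n : ℕ => 1 / (n : ℂ) := by
    refine IsBigO.of_bound (u ^ 2) (Eventually.of_forall fun n => ?_)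
    rw [div_pow, Real.sq_sqrt (Nat.cast_nonneg n)]
    simp [div_eq_mul_inv]
  refine (h.trans_isBigO h1).congr_left fun n => ?_
  simp only [Function.comp_apply]
  rw [← Complex.ofReal_pow, div_pow, Real.sq_sqrt (Nat.cast_nonneg n)]
  push_cast
  ring

/-! ### Saddle-point asymptotics -/

noncomputable section

/-- The integrand of `saddleIntegral`. -/
def saddleIntegrand (t x f : ℝ) (n m : ℕ) (v : ℝ) : ℂ :=
  tiltedChar t x v ^ n * Complex.exp (f * v * Complex.I) * ((t : ℂ) + v * Complex.I) ^ m /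
    ((t : ℂ) + v * Complex.I)

/-- The integral over a vertical line through the saddle point to which backward differences of
truncated powers reduce. -/
def saddleIntegral (t x f : ℝ) (n m : ℕ) : ℂ := ∫ v : ℝ, saddleIntegrand t x f n m v

end

theorem splineDiff_eq_saddleIntegral {t : ℝ} (ht : 0 < t) {n m : ℕ} (hm : m < n) {x f : ℝ} {a : ℤ}
    (ha : (a : ℝ) = n * (1 - x) + f) :
    (splineDiff n m a : ℂ) =
      (Real.exp (t * a) * ((1 - Real.exp (-t)) / t) ^ n / (2 * Real.pi) : ℝ) *
        saddleIntegral t x f n m := by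
  rw [splineDiff_eq_integral ht hm, saddleIntegral, ← integral_const_mul, ← integral_const_mul]
  congr 1
  ext v
  have hne := add_mul_I_ne_zero ht v
  have h1 : (1 - Complex.exp (-t) : ℂ) ≠ 0 := by exact_mod_cast (one_sub_exp_neg_pos ht).ne'
  have h3 : (t : ℂ) ≠ 0 := by exact_mod_cast ht.ne'
  have ha' : (a : ℂ) = n * (1 - x) + f := by exact_mod_cast ha
  have h4 : Complex.exp (((t : ℂ) + v * Complex.I) * a) = Complex.exp (t * a) *
      Complex.exp ((1 - x) * v * Complex.I) ^ n * Complex.exp (f * v * Complex.I) := by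
    rw [← Complex.exp_nat_mul, ← Complex.exp_add, ← Complex.exp_add, ha']
    congr 1
    ring
  obtain ⟨k, rfl⟩ : ∃ k, n = m + k := ⟨n - m, by omega⟩
  rw [saddleIntegrand, tiltedChar, h4, Nat.add_sub_cancel_left]
  push_cast
  set z : ℂ := (t : ℂ) + v * Complex.I
  simp only [mul_pow, div_pow, pow_add, pow_one]
  field_simp

theorem norm_cexp_mul_mul_I (f v : ℝ) : ‖Complex.exp (f * v * Complex.I)‖ = 1 := by
  rw [Complex.norm_exp]; simp

theorem norm_saddleIntegrand_le {t : ℝ} (ht : 0 < t) (x f v : ℝ) {n m : ℕ} (hm : m ≤ n) :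
    ‖saddleIntegrand t x f n m v‖ ≤ (2 * t / (1 - Real.exp (-t))) ^ m *
      (‖tiltedChar t x v‖ ^ (n - m) * ‖(t : ℂ) + v * Complex.I‖⁻¹) := by
  have h := norm_mul_tiltedChar_le ht x v
  obtain ⟨k, rfl⟩ := Nat.exists_eq_add_of_le hm
  rw [saddleIntegrand, norm_div, norm_mul, norm_mul, norm_cexp_mul_mul_I, norm_pow, norm_pow,
    Nat.add_sub_cancel_left]
  refine le_trans (le_of_eq ?_) (mul_le_mul_of_nonneg_right (pow_le_pow_left₀ (by positivity) h m)
    (by positivity))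
  rw [mul_pow, pow_add]
  ring

theorem integrable_inv_one_add_mul_sq {b : ℝ} (hb : 0 < b) :
    Integrable fun v : ℝ => (1 + b * v ^ 2)⁻¹ := by
  refine (integrable_inv_one_add_sq.comp_mul_right' (Real.sqrt_pos.2 hb).ne').congr
    (ae_of_all _ fun v => ?_)
  simp only [mul_pow, Real.sq_sqrt hb.le, mul_comm]

theorem integral_inv_one_add_mul_sq {b : ℝ} (hb : 0 < b) :
    ∫ v : ℝ, (1 + b * v ^ 2)⁻¹ = Real.pi / Real.sqrt b := by
  have h := Measure.integral_comp_mul_right (fun v : ℝ => (1 + v ^ 2)⁻¹) (Real.sqrt b)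
  rw [integral_univ_inv_one_add_sq, abs_of_pos (inv_pos.2 (Real.sqrt_pos.2 hb)), smul_eq_mul] at h
  rw [div_eq_mul_inv, mul_comm, ← h]
  congr 1
  ext v
  rw [mul_pow, Real.sq_sqrt hb.le, mul_comm]

/-- For `N ≥ 2` a Cauchy density of width of order `1 / √N` dominates. For `N = 1` that bound is
unavailable, and `norm_mul_tiltedChar_le` gives decay like `‖z‖⁻²` instead. -/
theorem exists_integral_norm_tiltedChar_le {t s : ℝ} (ht : 0 < t)
    (hs : s = 1 / t ^ 2 - expRatio t) (hs0 : 0 < s) (x : ℝ) :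
    ∃ K : ℝ, 0 ≤ K ∧ ∀ N : ℕ, N ≠ 0 → ∃ g : ℝ → ℝ, Integrable g ∧
      (∀ v, ‖tiltedChar t x v‖ ^ N * ‖(t : ℂ) + v * Complex.I‖⁻¹ ≤ g v) ∧
      ∫ v, g v ≤ K / Real.sqrt N := by
  have hk := expRatio_pos ht
  have h1 := one_sub_exp_neg_pos ht
  set c := s / (1 + 4 * expRatio t) with hc_def
  have hc : 0 < c := by positivity
  set B := 2 * t / (1 - Real.exp (-t)) with hB_def
  have hB : 0 < B := by positivity
  set g₁ : ℝ → ℝ := fun v => B * (‖(t : ℂ) + v * Complex.I‖ ^ 2)⁻¹ with hg₁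
  have hg₁0 : 0 ≤ ∫ v, g₁ v := integral_nonneg fun v => by positivity
  set K₂ := t⁻¹ * (Real.pi / Real.sqrt (c / 2)) with hK₂
  have hK₂0 : 0 ≤ K₂ := by positivity
  refine ⟨(∫ v, g₁ v) + K₂, by positivity, fun N hN => ?_⟩
  rcases Nat.lt_or_ge N 2 with hN2 | hN2
  · obtain rfl : N = 1 := by omega
    refine ⟨g₁, (integrable_inv_sq_norm_add_mul_I ht).const_mul B, fun v => ?_, ?_⟩
    · have h4 : 0 < ‖(t : ℂ) + v * Complex.I‖ := ht.trans_le (le_norm_add_mul_I ht v)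
      have h5 := norm_mul_tiltedChar_le ht x v
      rw [pow_one, hg₁]
      refine le_trans (le_of_eq ?_) (mul_le_mul_of_nonneg_right h5 (by positivity))
      field_simp
    · simp only [Nat.cast_one, Real.sqrt_one, div_one]
      linarith
  · have hN0 : (0 : ℝ) < N := by exact_mod_cast Nat.pos_of_ne_zero hN
    refine ⟨fun v => t⁻¹ * (1 + N * (c / 2) * v ^ 2)⁻¹,
      (integrable_inv_one_add_mul_sq (by positivity)).const_mul _, fun v => ?_, ?_⟩
    · have h5 := norm_tiltedChar_pow_le ht hs hs0 x v hN2
      rw [← hc_def, show N * c * v ^ 2 / 2 = N * (c / 2) * v ^ 2 by ring] at h5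
      rw [mul_comm]
      exact mul_le_mul (inv_anti₀ ht (le_norm_add_mul_I ht v)) h5 (by positivity) (by positivity)
    · rw [integral_const_mul, integral_inv_one_add_mul_sq (by positivity),
        Real.sqrt_mul hN0.le]
      have : 0 ≤ (∫ v, g₁ v) / Real.sqrt N := by positivity
      rw [add_div]
      refine le_trans (le_of_eq ?_) (le_add_of_nonneg_left this)
      rw [hK₂]
      have : 0 < Real.sqrt (c / 2) := Real.sqrt_pos.2 (by positivity)
      field_simp

theorem exists_norm_saddleIntegral_le {t s : ℝ} (ht : 0 < t)
    (hs : s = 1 / t ^ 2 - expRatio t) (hs0 : 0 < s) (x : ℝ) :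
    ∃ K B : ℝ, 0 ≤ K ∧ 0 ≤ B ∧ ∀ (n m : ℕ) (f : ℝ), m < n →
      Real.sqrt n * ‖saddleIntegral t x f n m‖ ≤ K * B ^ m := by
  obtain ⟨K, hK, h⟩ := exists_integral_norm_tiltedChar_le ht hs hs0 x
  have h1 := one_sub_exp_neg_pos ht
  set B := 2 * t / (1 - Real.exp (-t)) with hB_def
  have hB : 0 < B := by positivity
  refine ⟨K, 2 * B, hK, by positivity, fun n m f hm => ?_⟩
  obtain ⟨g, hg, hgb, hgi⟩ := h (n - m) (by omega)
  have h2 : ‖saddleIntegral t x f n m‖ ≤ ∫ v, B ^ m * g v :=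
    norm_integral_le_of_norm_le (hg.const_mul _) (ae_of_all _ fun v =>
      (norm_saddleIntegrand_le ht x f v hm.le).trans
        (mul_le_mul_of_nonneg_left (hgb v) (by positivity)))
  rw [integral_const_mul] at h2
  have hN : (0 : ℝ) < (n - m : ℕ) := by exact_mod_cast Nat.sub_pos_of_lt hm
  -- Absorbing `z ^ m` leaves only `n - m` characteristic functions; the loss `√(n / (n - m)) ≤ √(m
  -- + 1)` is still geometric in `m`.
  have h3 : Real.sqrt n ≤ 2 ^ m * Real.sqrt (n - m : ℕ) := by
    rw [← Real.sqrt_sq (show (0 : ℝ) ≤ 2 ^ m by positivity), ← Real.sqrt_mul (by positivity)]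
    refine Real.sqrt_le_sqrt ?_
    have h4 : m + 1 ≤ 2 ^ m := Nat.lt_two_pow_self
    have h5 : n ≤ (m + 1) * (n - m) := by
      obtain ⟨k, rfl⟩ : ∃ k, n = m + 1 + k := ⟨n - (m + 1), by omega⟩
      rw [show m + 1 + k - m = k + 1 by omega]
      nlinarith
    have h6 : n ≤ (2 ^ m) ^ 2 * (n - m) := by
      refine h5.trans (Nat.mul_le_mul_right _ (h4.trans ?_))
      exact Nat.le_self_pow two_ne_zero _
    exact_mod_cast h6
  have hsq : 0 < Real.sqrt (n - m : ℕ) := Real.sqrt_pos.2 hN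
  calc Real.sqrt n * ‖saddleIntegral t x f n m‖
      ≤ (2 ^ m * Real.sqrt (n - m : ℕ)) * (B ^ m * (K / Real.sqrt (n - m : ℕ))) := by
        refine mul_le_mul h3 (h2.trans ?_) (norm_nonneg _) (by positivity)
        gcongr
    _ = K * (2 * B) ^ m := by
        rw [mul_pow]
        field_simp

theorem continuous_saddleIntegrand {t : ℝ} (ht : 0 < t) (x f : ℝ) (n m : ℕ) :
    Continuous (saddleIntegrand t x f n m) := by
  have := continuous_tiltedChar ht x
  unfold saddleIntegrand
  exact Continuous.div (by fun_prop) (by fun_prop) fun v => add_mul_I_ne_zero ht v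

theorem tendsto_sqrt_mul_saddleIntegral {t x s : ℝ} (ht : 0 < t)
    (hx : x = 1 / (1 - Real.exp (-t)) - 1 / t) (hs : s = 1 / t ^ 2 - expRatio t) (hs0 : 0 < s)
    {f : ℕ → ℝ} (hf : ∀ n, |f n| ≤ 1) (m : ℕ) :
    Tendsto (fun n : ℕ => (Real.sqrt n : ℂ) * saddleIntegral t x (f n) n m) atTop
      (nhds ((t ^ m / t * Real.sqrt (2 * Real.pi / s) : ℝ) : ℂ)) := by
  have hk := expRatio_pos ht
  have h1 := one_sub_exp_neg_pos ht
  have hlim : ((t ^ m / t * Real.sqrt (2 * Real.pi / s) : ℝ) : ℂ) =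
      ∫ u : ℝ, Complex.exp (-(s * u ^ 2 / 2)) * 1 * (t : ℂ) ^ m / t := by
    have h := integral_gaussian (s / 2)
    rw [show Real.pi / (s / 2) = 2 * Real.pi / s by field_simp] at h
    rw [← h, ← integral_const_mul, ← integral_complex_ofReal]
    congr 1
    ext u
    push_cast
    rw [show -((s : ℂ) / 2) * u ^ 2 = -(s * u ^ 2 / 2) by ring]
    ring
  have hscale : ∀ᶠ n : ℕ in atTop, ∫ u : ℝ, saddleIntegrand t x (f n) n m (u / Real.sqrt n) =
      (Real.sqrt n : ℂ) * saddleIntegral t x (f n) n m := by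
    filter_upwards [eventually_gt_atTop 0] with n hn
    rw [Measure.integral_comp_div, abs_of_nonneg (Real.sqrt_nonneg _), Complex.real_smul]
    rfl
  rw [hlim]
  refine Tendsto.congr' hscale ?_
  set c := s / (1 + 4 * expRatio t) with hc_def
  have hc : 0 < c := by positivity
  set B := 2 * t / (1 - Real.exp (-t)) with hB_def
  refine tendsto_integral_filter_of_dominated_convergence
    (fun u => B ^ m * (t⁻¹ * (1 + c / 4 * u ^ 2)⁻¹)) (Eventually.of_forall fun n => ?_) ?_ ?_
    (ae_of_all _ fun u => ?_)
  · exact ((continuous_saddleIntegrand ht x (f n) n m).comp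
      (continuous_id.div_const _)).aestronglyMeasurable
  -- This threshold gives both `n - m ≥ 2`, needed for the Cauchy bound, and `n - m ≥ n / 2`, which
  -- makes the bound free of `n` after scaling.
  · filter_upwards [eventually_ge_atTop (2 * m + 2)] with n hn
    refine ae_of_all _ fun u => ?_
    refine (norm_saddleIntegrand_le ht x (f n) _ (by omega)).trans ?_
    have h5 := norm_tiltedChar_pow_le ht hs hs0 x (u / Real.sqrt n) (n := n - m) (by omega)
    have hn0 : (0 : ℝ) < n := by exact_mod_cast (by omega : 0 < n)
    have h6 : (1 + ((n - m : ℕ) : ℝ) * c * (u / Real.sqrt n) ^ 2 / 2)⁻¹ ≤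
        (1 + c / 4 * u ^ 2)⁻¹ := by
      have h7 : (n : ℝ) / 2 ≤ ((n - m : ℕ) : ℝ) := by
        rw [Nat.cast_sub (by omega)]
        have : (2 * m + 2 : ℝ) ≤ n := by exact_mod_cast hn
        linarith
      have h8 : c / 4 * u ^ 2 = (n : ℝ) / 2 * c * (u / Real.sqrt n) ^ 2 / 2 := by
        rw [div_pow, Real.sq_sqrt hn0.le]
        field_simp
        ring
      rw [h8]
      gcongr
    rw [mul_comm (‖tiltedChar t x _‖ ^ _)]
    gcongr
    · exact le_norm_add_mul_I ht _
    · exact h5.trans h6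
  · exact ((integrable_inv_one_add_mul_sq (by positivity)).const_mul _).const_mul _
  · have h0 : Tendsto (fun n : ℕ => u / Real.sqrt n) atTop (nhds 0) :=
      tendsto_const_nhds.div_atTop (Real.tendsto_sqrt_atTop.comp tendsto_natCast_atTop_atTop)
    have hz : Tendsto (fun n : ℕ => (t : ℂ) + (u / Real.sqrt n : ℝ) * Complex.I) atTop
        (nhds (t : ℂ)) := by
      have := (((Complex.continuous_ofReal.tendsto 0).comp h0).mul_const Complex.I).const_add (t : ℂ)
      simpa using this
    have hfz : Tendsto (fun n : ℕ => f n * (u / Real.sqrt n)) atTop (nhds 0) := by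
      refine squeeze_zero_norm (a := fun n : ℕ => ‖u / Real.sqrt n‖) (fun n => ?_)
        (by simpa using h0.norm)
      rw [norm_mul]
      exact mul_le_of_le_one_left (norm_nonneg _) (hf n)
    have he : Tendsto (fun n : ℕ => Complex.exp (f n * (u / Real.sqrt n : ℝ) * Complex.I)) atTop
        (nhds 1) := by
      have := (((Complex.continuous_ofReal.tendsto 0).comp hfz).mul_const Complex.I).cexp
      simpa using this
    have htne : (t : ℂ) ≠ 0 := by exact_mod_cast ht.ne'
    exact (((tendsto_tiltedChar_pow ht hx hs u).mul he).mul (hz.pow m)).div hz htne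

/-! ### The cumulant generating function, the saddle point and the rate function -/

/-- Positivity of `L''(t)`, which amounts to `sinh (t / 2) > t / 2`. -/
theorem one_div_sq_sub_expRatio_pos {t : ℝ} (ht : 0 < t) :
    0 < 1 / t ^ 2 - expRatio t := by
  have h1 := one_sub_exp_neg_pos ht
  have h2 := Real.self_lt_sinh_iff.2 (half_pos ht)
  rw [Real.sinh_eq] at h2
  have h3 : t * Real.exp (-(t / 2)) < 1 - Real.exp (-t) := by
    have h4 : Real.exp (t / 2) * Real.exp (-(t / 2)) = 1 := by rw [← Real.exp_add]; simp
    have h5 : Real.exp (-(t / 2)) * Real.exp (-(t / 2)) = Real.exp (-t) := by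
      rw [← Real.exp_add]; ring_nf
    have h6 := mul_lt_mul_of_pos_right h2 (Real.exp_pos (-(t / 2)))
    nlinarith
  have h7 : t ^ 2 * Real.exp (-t) < (1 - Real.exp (-t)) ^ 2 := by
    have h5 : Real.exp (-(t / 2)) ^ 2 = Real.exp (-t) := by
      rw [← Real.exp_nat_mul]; push_cast; ring_nf
    rw [← h5, ← mul_pow]
    rw [h5]
    gcongr
  rw [sub_pos, expRatio, div_lt_div_iff₀ (by positivity) (by positivity)]
  linarith

theorem exp_sub_one_div_pos {t : ℝ} (ht : t ≠ 0) : 0 < (Real.exp t - 1) / t := by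
  rcases ht.lt_or_gt with h | h
  · exact div_pos_of_neg_of_neg (by linarith [Real.exp_lt_one_iff.2 h]) h
  · exact div_pos (by linarith [Real.one_lt_exp_iff.2 h]) h

theorem hasDerivAt_cumulantL {t : ℝ} (ht : t ≠ 0) :
    HasDerivAt cumulantL (1 / (1 - Real.exp (-t)) - 1 / t) t := by
  have h1 : HasDerivAt (fun t => Real.log ((Real.exp t - 1) / t))
      (((Real.exp t * t - (Real.exp t - 1) * 1) / t ^ 2) / ((Real.exp t - 1) / t)) t :=
    (((Real.hasDerivAt_exp t).sub_const 1).div (hasDerivAt_id t) ht).log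
      (exp_sub_one_div_pos ht).ne'
  have h2 : cumulantL =ᶠ[nhds t] fun t => Real.log ((Real.exp t - 1) / t) := by
    filter_upwards [isOpen_ne.mem_nhds ht] with u hu
    rw [cumulantL, if_neg hu]
  refine (h1.congr_of_eventuallyEq h2).congr_deriv ?_
  have h3 : Real.exp t - 1 ≠ 0 := by
    rw [sub_ne_zero, Ne, Real.exp_eq_one_iff]; exact ht
  have h4 : Real.exp t ≠ 0 := (Real.exp_pos t).ne'
  have h5 : 1 - Real.exp (-t) = (Real.exp t - 1) / Real.exp t := by
    rw [Real.exp_neg]; field_simp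
  rw [h5]
  field_simp

theorem hasDerivAt_deriv_cumulantL {t : ℝ} (ht : 0 < t) :
    HasDerivAt (deriv cumulantL) (1 / t ^ 2 - expRatio t) t := by
  have h2 : deriv cumulantL =ᶠ[nhds t] fun t => (1 - Real.exp (-t))⁻¹ - t⁻¹ := by
    filter_upwards [isOpen_ne.mem_nhds ht.ne'] with u hu
    rw [(hasDerivAt_cumulantL hu).deriv, one_div, one_div]
  have h1 := (one_sub_exp_neg_pos ht).ne'
  have h3 := ((((hasDerivAt_neg t).exp).const_sub 1).inv h1).sub (hasDerivAt_inv ht.ne')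
  refine (h3.congr_of_eventuallyEq h2).congr_deriv ?_
  rw [expRatio]
  field_simp
  ring

theorem strictMonoOn_deriv_cumulantL : StrictMonoOn (deriv cumulantL) (Set.Ioi 0) := by
  refine strictMonoOn_of_deriv_pos (convex_Ioi 0) (fun t ht => ?_) fun t ht => ?_
  · exact (hasDerivAt_deriv_cumulantL ht).continuousAt.continuousWithinAt
  · rw [interior_Ioi] at ht
    rw [(hasDerivAt_deriv_cumulantL ht).deriv]
    exact one_div_sq_sub_expRatio_pos ht

theorem deriv_cumulantL_neg {t : ℝ} (ht : t ≠ 0) :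
    deriv cumulantL (-t) = 1 - deriv cumulantL t := by
  rw [(hasDerivAt_cumulantL ht).deriv, (hasDerivAt_cumulantL (neg_ne_zero.2 ht)).deriv, neg_neg]
  have h3 : Real.exp t - 1 ≠ 0 := by
    rw [sub_ne_zero, Ne, Real.exp_eq_one_iff]; exact ht
  have h4 : Real.exp t ≠ 0 := (Real.exp_pos t).ne'
  have h5 : 1 - Real.exp (-t) = (Real.exp t - 1) / Real.exp t := by
    rw [Real.exp_neg]; field_simp
  have h6 : 1 - Real.exp t ≠ 0 := by rwa [← neg_ne_zero, neg_sub]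
  rw [h5, ← neg_sub (Real.exp t) 1]
  field_simp
  ring

theorem cumulantL_neg (t : ℝ) : cumulantL (-t) = cumulantL t - t := by
  rcases eq_or_ne t 0 with rfl | ht
  · simp
  rw [cumulantL, cumulantL, if_neg ht, if_neg (neg_ne_zero.2 ht)]
  nth_rewrite 5 [← Real.log_exp t]
  rw [← Real.log_div (exp_sub_one_div_pos ht).ne' (Real.exp_pos _).ne']
  congr 1
  have h4 : Real.exp t ≠ 0 := (Real.exp_pos t).ne'
  rw [Real.exp_neg]
  field_simp
  ring

/-- Differentiability at `0` need not be decided: if it holds, the symmetry `L(-t) = L(t) - t`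
forces the value `1 / 2`, and otherwise `deriv` takes its default value `0`. Either way `0` is
excluded as a saddle for `x > 1 / 2`. -/
theorem deriv_cumulantL_zero_le : deriv cumulantL 0 ≤ 1 / 2 := by
  by_cases h : DifferentiableAt ℝ cumulantL 0
  · have h1 : HasDerivAt cumulantL (deriv cumulantL 0) (-0) := by rw [neg_zero]; exact h.hasDerivAt
    have h2 := h1.scomp (0 : ℝ) (hasDerivAt_neg (0 : ℝ))
    have h3 : cumulantL ∘ Neg.neg = fun t => cumulantL t - t := funext cumulantL_neg
    rw [h3] at h2
    have h4 := h2.unique (h.hasDerivAt.sub (hasDerivAt_id 0))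
    simp only [smul_eq_mul] at h4
    linarith
  · rw [deriv_zero_of_not_differentiableAt h]
    norm_num

theorem deriv_cumulantL_le {t : ℝ} (ht : 0 < t) (ht1 : t < 2) :
    deriv cumulantL t ≤ 1 / (2 - t) := by
  rw [(hasDerivAt_cumulantL ht.ne').deriv]
  have h1 : t - t ^ 2 / 2 ≤ 1 - Real.exp (-t) := by
    have h6 := Real.quadratic_le_exp_of_nonneg ht.le
    have h7 : (1 - t + t ^ 2 / 2) * (1 + t + t ^ 2 / 2) = 1 + t ^ 4 / 4 := by ring
    have h8 : 0 ≤ 1 - t + t ^ 2 / 2 := by nlinarith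
    have h9 : Real.exp (-t) ≤ 1 - t + t ^ 2 / 2 := by
      rw [Real.exp_neg, inv_le_iff_one_le_mul₀ (Real.exp_pos t)]
      have := mul_le_mul_of_nonneg_left h6 h8
      have : 0 ≤ t ^ 4 := by positivity
      linarith
    linarith
  have h2 : 0 < t - t ^ 2 / 2 := by nlinarith
  have h3 : 1 / (1 - Real.exp (-t)) ≤ 1 / (t - t ^ 2 / 2) := one_div_le_one_div_of_le h2 h1
  refine (sub_le_sub_right h3 _).trans_eq ?_
  have h4 : (2 - t) ≠ 0 := by linarith
  have h5 : t - t ^ 2 / 2 = t * (2 - t) / 2 := by ring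
  rw [h5]
  field_simp
  ring

theorem half_le_deriv_cumulantL {t : ℝ} (ht : 0 < t) : 1 / 2 ≤ deriv cumulantL t := by
  have h1 := (one_sub_exp_neg_pos ht)
  rw [(hasDerivAt_cumulantL ht.ne').deriv]
  have h2 : (2 - t) ≤ (2 + t) * Real.exp (-t) := by
    have hd : ∀ u : ℝ, HasDerivAt (fun u => (2 + u) * Real.exp (-u) - (2 - u))
        (1 - (1 + u) * Real.exp (-u)) u := fun u => by
      refine ((((hasDerivAt_id u).const_add 2).mul (hasDerivAt_neg u).exp).sub
        ((hasDerivAt_id u).const_sub 2)).congr_deriv ?_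
      simp only [id]
      ring
    have hm : MonotoneOn (fun u => (2 + u) * Real.exp (-u) - (2 - u)) (Set.Ici 0) := by
      refine monotoneOn_of_deriv_nonneg (convex_Ici 0) (by fun_prop) (by fun_prop) fun u _ => ?_
      rw [(hd u).deriv, sub_nonneg, Real.exp_neg, ← div_eq_mul_inv, div_le_one (Real.exp_pos u),
        add_comm]
      exact Real.add_one_le_exp u
    have := hm Set.self_mem_Ici ht.le ht.le
    simp only [add_zero, neg_zero, Real.exp_zero, sub_zero, mul_one, sub_self] at this
    linarith
  rw [div_sub_div _ _ h1.ne' ht.ne', div_le_div_iff₀ (by norm_num) (by positivity)]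
  nlinarith

theorem tendsto_deriv_cumulantL : Tendsto (deriv cumulantL) atTop (nhds 1) := by
  have h : Tendsto (fun t : ℝ => 1 / (1 - Real.exp (-t)) - 1 / t) atTop (nhds (1 / (1 - 0) - 0)) := by
    refine Tendsto.sub (tendsto_const_nhds.div (tendsto_const_nhds.sub ?_) (by norm_num)) ?_
    · exact Real.tendsto_exp_neg_atTop_nhds_zero
    · exact tendsto_const_nhds.div_atTop tendsto_id
  norm_num at h
  refine h.congr' ?_
  filter_upwards [eventually_gt_atTop 0] with t ht
  rw [(hasDerivAt_cumulantL ht.ne').deriv, one_div, one_div]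

theorem exists_unique_deriv_cumulantL {x : ℝ} (hx : 1 / 2 < x) (hx1 : x < 1) :
    ∃ t : ℝ, 0 < t ∧ deriv cumulantL t = x ∧ ∀ u : ℝ, deriv cumulantL u = x → u = t := by
  obtain ⟨b, hb, hb0⟩ : ∃ b, x < deriv cumulantL b ∧ 0 < b :=
    ((tendsto_deriv_cumulantL.eventually (lt_mem_nhds hx1)).and (eventually_gt_atTop 0)).exists
  -- At `t = 2 - 1 / x` the bound `1 / (2 - t)` equals `x`, giving a left endpoint for the
  -- intermediate value theorem away from `0`.
  set a := min b (2 - 1 / x) with ha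
  have hx0 : 0 < x := by linarith
  have h1 : 1 / x < 2 := by rw [div_lt_iff₀ hx0]; linarith
  have h2 : 1 < 1 / x := by rw [lt_div_iff₀ hx0]; linarith
  have ha0 : 0 < a := lt_min hb0 (by linarith)
  have ha2 : a ≤ 2 - 1 / x := min_le_right _ _
  have hax : deriv cumulantL a ≤ x := by
    refine (deriv_cumulantL_le ha0 (by linarith)).trans ?_
    rw [div_le_iff₀ (by linarith)]
    have : x * (1 / x) ≤ x * (2 - a) := by gcongr; linarith
    rwa [mul_one_div_cancel hx0.ne'] at this
  obtain ⟨t, ht, htx⟩ := intermediate_value_Icc (min_le_left b (2 - 1 / x))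
    (fun u hu => (hasDerivAt_deriv_cumulantL (ha0.trans_le hu.1)).continuousAt.continuousWithinAt)
    ⟨hax, hb.le⟩
  have ht0 : 0 < t := ha0.trans_le ht.1
  refine ⟨t, ht0, htx, fun u hu => ?_⟩
  rcases lt_trichotomy u 0 with h | rfl | h
  · have h3 := deriv_cumulantL_neg (neg_ne_zero.2 h.ne)
    rw [neg_neg] at h3
    have h4 := half_le_deriv_cumulantL (neg_pos.2 h)
    linarith
  · linarith [deriv_cumulantL_zero_le]
  · exact strictMonoOn_deriv_cumulantL.injOn h ht0 (hu.trans htx.symm)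

theorem exp_cumulantL (t : ℝ) : Real.exp (cumulantL t) = ∫ s in (0 : ℝ)..1, Real.exp (t * s) := by
  rcases eq_or_ne t 0 with rfl | ht
  · simp [cumulantL]
  · rw [cumulantL, if_neg ht, Real.exp_log (exp_sub_one_div_pos ht), intervalIntegral.integral_comp_mul_left _ ht]
    simp [div_eq_inv_mul]

theorem integral_mul_exp_mul {t : ℝ} (ht : t ≠ 0) :
    ∫ s in (0 : ℝ)..1, s * Real.exp (t * s) =
      deriv cumulantL t * Real.exp (cumulantL t) := by
  have h1 : ∀ s ∈ Set.uIcc (0 : ℝ) 1,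
      HasDerivAt (fun s => (s / t - 1 / t ^ 2) * Real.exp (t * s)) (s * Real.exp (t * s)) s := by
    intro s _
    have h := (((hasDerivAt_id s).div_const t).sub_const (1 / t ^ 2)).mul
      ((hasDerivAt_id s).const_mul t).exp
    refine h.congr_deriv ?_
    simp only [id]
    field_simp
    ring
  rw [intervalIntegral.integral_eq_sub_of_hasDerivAt h1
    (Continuous.intervalIntegrable (by fun_prop) _ _), (hasDerivAt_cumulantL ht).deriv, cumulantL,
    if_neg ht, Real.exp_log (exp_sub_one_div_pos ht)]
  have h3 : Real.exp t - 1 ≠ 0 := by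
    rw [sub_ne_zero, Ne, Real.exp_eq_one_iff]; exact ht
  have h4 : Real.exp t ≠ 0 := (Real.exp_pos t).ne'
  have h5 : 1 - Real.exp (-t) = (Real.exp t - 1) / Real.exp t := by
    rw [Real.exp_neg]; field_simp
  rw [h5]
  simp only [mul_one, mul_zero, Real.exp_zero]
  field_simp
  ring

/-- `exp ∘ L` is the moment generating function of the uniform law. Integrating `exp ((u - t) * (s -
x)) ≥ 1 + (u - t) * (s - x)` against `exp (t * s)` kills the linear term, because `x` is the tilted
mean. This gives the tangent-line inequality for every `u`, without studying convexity of `L` at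
`0`. -/
theorem mul_sub_cumulantL_le {x t : ℝ} (ht : t ≠ 0) (hx : deriv cumulantL t = x) (u : ℝ) :
    x * u - cumulantL u ≤ x * t - cumulantL t := by
  have h1 : Real.exp (cumulantL t) * Real.exp ((u - t) * x) ≤ Real.exp (cumulantL u) := by
    rw [exp_cumulantL u]
    have h2 : ∫ s in (0 : ℝ)..1, Real.exp ((u - t) * x) *
        (Real.exp (t * s) + (u - t) * (s * Real.exp (t * s) - x * Real.exp (t * s))) ≤
        ∫ s in (0 : ℝ)..1, Real.exp (u * s) := by
      refine intervalIntegral.integral_mono_on zero_le_one ?_ ?_ fun s _ => ?_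
      · exact Continuous.intervalIntegrable (by fun_prop) _ _
      · exact Continuous.intervalIntegrable (by fun_prop) _ _
      · have h3 := Real.add_one_le_exp ((u - t) * (s - x))
        have h4 : Real.exp (u * s) = Real.exp ((u - t) * x) * Real.exp (t * s) *
            Real.exp ((u - t) * (s - x)) := by
          rw [← Real.exp_add, ← Real.exp_add]; ring_nf
        have h5 := mul_le_mul_of_nonneg_left h3
          (by positivity : 0 ≤ Real.exp ((u - t) * x) * Real.exp (t * s))
        rw [h4]
        linarith
    refine le_trans (le_of_eq ?_) h2
    have hi1 : IntervalIntegrable (fun s => Real.exp (t * s)) volume 0 1 :=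
      Continuous.intervalIntegrable (by fun_prop) _ _
    have hi2 : IntervalIntegrable (fun s => s * Real.exp (t * s)) volume 0 1 :=
      Continuous.intervalIntegrable (by fun_prop) _ _
    rw [intervalIntegral.integral_const_mul, intervalIntegral.integral_add hi1
      ((hi2.sub (hi1.const_mul x)).const_mul _), intervalIntegral.integral_const_mul,
      intervalIntegral.integral_sub hi2 (hi1.const_mul x), intervalIntegral.integral_const_mul,
      integral_mul_exp_mul ht, ← exp_cumulantL, hx]
    ring
  rw [← Real.exp_add, Real.exp_le_exp] at h1
  linarith

theorem bddAbove_range_mul_sub_cumulantL {x t : ℝ} (ht : t ≠ 0) (hx : deriv cumulantL t = x) :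
    BddAbove (Set.range fun u : ℝ => x * u - cumulantL u) :=
  ⟨x * t - cumulantL t, by rintro _ ⟨u, rfl⟩; exact mul_sub_cumulantL_le ht hx u⟩

theorem rateI_eq {x t : ℝ} (ht : t ≠ 0) (hx : deriv cumulantL t = x) :
    rateI x = x * t - cumulantL t :=
  le_antisymm (ciSup_le (mul_sub_cumulantL_le ht hx))
    (le_ciSup (bddAbove_range_mul_sub_cumulantL ht hx) t)

theorem exp_neg_mul_rateI {x t f : ℝ} (ht : 0 < t) (hx : deriv cumulantL t = x) {n : ℕ} {a : ℤ}
    (ha : (a : ℝ) = n * (1 - x) + f) :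
    Real.exp (t * a) * ((1 - Real.exp (-t)) / t) ^ n = Real.exp (-(n * rateI x) + f * t) := by
  have h1 : (1 - Real.exp (-t)) / t = Real.exp (-t) * Real.exp (cumulantL t) := by
    rw [cumulantL, if_neg ht.ne', Real.exp_log (exp_sub_one_div_pos ht.ne'), Real.exp_neg]
    have h4 : Real.exp t ≠ 0 := (Real.exp_pos t).ne'
    field_simp
  rw [h1, ← Real.exp_add, ← Real.exp_nat_mul, ← Real.exp_add, rateI_eq ht.ne' hx, ha]
  congr 1
  ring

/-! ### Summation over `m` -/

/-- Dominated convergence for series: the terms are dominated by `C ^ m / m!` up to a constant, and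
the termwise limits form the exponential series of `ε * t * t' / 2`. -/
theorem tendsto_sum_stirlingWeight {R R' : ℕ → ℕ → ℝ} {c c' t t' K K' B B' ε : ℝ}
    (hε : |ε| = 1) (hK : 0 ≤ K) (hB : 0 ≤ B) (hK' : 0 ≤ K') (hB' : 0 ≤ B')
    (hR : ∀ m, Tendsto (fun n => R n m) atTop (nhds (t ^ m * c)))
    (hR' : ∀ m, Tendsto (fun n => R' n m) atTop (nhds (t' ^ m * c')))
    (hb : ∀ n m, m < n → |R n m| ≤ K * B ^ m) (hb' : ∀ n m, m < n → |R' n m| ≤ K' * B' ^ m) :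
    Tendsto (fun n => ∑ m ∈ Finset.range n, ε ^ m * stirlingWeight n m * R n m * R' n m) atTop
      (nhds (Real.exp (ε * (1 / 2 * (t * t'))) * (c * c'))) := by
  have h1 : ∀ n, ∑ m ∈ Finset.range n, ε ^ m * stirlingWeight n m * R n m * R' n m =
      ∑' m, if m < n then ε ^ m * stirlingWeight n m * R n m * R' n m else 0 := by
    intro n
    rw [tsum_eq_sum (s := Finset.range n) fun m hm => if_neg (by simpa using hm)]
    exact Finset.sum_congr rfl fun m hm => (if_pos (Finset.mem_range.1 hm)).symm
  have h2 : Real.exp (ε * (1 / 2 * (t * t'))) * (c * c') =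
      ∑' m : ℕ, ε ^ m * (1 / (2 ^ m * m.factorial)) * (t ^ m * c) * (t' ^ m * c') := by
    rw [Real.exp_eq_exp_ℝ, NormedSpace.exp_eq_tsum_div, ← tsum_mul_right]
    refine tsum_congr fun m => ?_
    simp only [mul_pow, div_pow, one_pow]
    field_simp
  simp only [h1]
  rw [h2]
  refine tendsto_tsum_of_dominated_convergence
    (bound := fun m => (Real.exp 2 / 2 * B * B') ^ m / m.factorial * (K * K'))
    ((Real.summable_pow_div_factorial _).mul_right _) (fun m => ?_) ?_
  · have h3 : Tendsto (fun n => ε ^ m * stirlingWeight n m * R n m * R' n m) atTop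
        (nhds (ε ^ m * (1 / (2 ^ m * m.factorial)) * (t ^ m * c) * (t' ^ m * c'))) :=
      (((tendsto_stirlingWeight m).const_mul _).mul (hR m)).mul (hR' m)
    refine h3.congr' ?_
    filter_upwards [eventually_gt_atTop m] with n hn
    rw [if_pos hn]
  · filter_upwards [eventually_gt_atTop 0] with n hn m
    by_cases hm : m < n
    · rw [if_pos hm, Real.norm_eq_abs, abs_mul, abs_mul, abs_mul, abs_pow, hε, one_pow, one_mul,
        abs_of_nonneg (stirlingWeight_nonneg n m)]
      calc stirlingWeight n m * |R n m| * |R' n m|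
          ≤ ((Real.exp 2 / 2) ^ m / m.factorial) * (K * B ^ m) * (K' * B' ^ m) :=
            mul_le_mul (mul_le_mul (stirlingWeight_le hn.ne' hm.le) (hb n m hm) (abs_nonneg _)
              (by positivity)) (hb' n m hm) (abs_nonneg _) (by positivity)
        _ = _ := by rw [mul_pow, mul_pow]; ring
    · rw [if_neg hm, norm_zero]
      positivity

/-- The integer `n - ⌈(n - 1) x⌉`. -/
noncomputable def lowerCutoff (n : ℕ) (x : ℝ) : ℤ := n - ⌈((n : ℝ) - 1) * x⌉

theorem lowerCutoff_eq (n : ℕ) (x : ℝ) : (lowerCutoff n x : ℝ) = n * (1 - x) + fracN n x := by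
  rw [lowerCutoff, fracN]
  push_cast
  ring

theorem abs_fracN_le {x : ℝ} (hx : 0 < x) (hx1 : x < 1) (n : ℕ) : |fracN n x| ≤ 1 := by
  have h1 := Int.le_ceil (((n : ℝ) - 1) * x)
  have h2 := Int.ceil_lt_add_one (((n : ℝ) - 1) * x)
  rw [fracN, abs_le]
  constructor <;> nlinarith

/-- Asymptotics of the backward differences of truncated powers on the large deviations scale. -/
theorem exists_splineDiff_eq {x t : ℝ} (hx : 0 < x) (hx1 : x < 1) (ht : 0 < t)
    (htx : deriv cumulantL t = x) :
    ∃ (R : ℕ → ℕ → ℝ) (K B : ℝ), 0 ≤ K ∧ 0 ≤ B ∧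
      (∀ n m, m < n → splineDiff n m (lowerCutoff n x) =
        Real.exp (-(n * rateI x) + fracN n x * t) / (2 * Real.pi * Real.sqrt n) * R n m) ∧
      (∀ m, Tendsto (fun n => R n m) atTop
        (nhds (t ^ m * (Real.sqrt (2 * Real.pi / deriv (deriv cumulantL) t) / t)))) ∧
      ∀ n m, m < n → |R n m| ≤ K * B ^ m := by
  have hs := (hasDerivAt_deriv_cumulantL ht).deriv
  set s := deriv (deriv cumulantL) t
  have hs0 : 0 < s := hs ▸ one_div_sq_sub_expRatio_pos ht
  have hx' : x = 1 / (1 - Real.exp (-t)) - 1 / t := by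
    rw [← htx, (hasDerivAt_cumulantL ht.ne').deriv]
  obtain ⟨K, B, hK, hB, hKB⟩ := exists_norm_saddleIntegral_le ht hs hs0 x
  refine ⟨fun n m => Real.sqrt n * (saddleIntegral t x (fracN n x) n m).re, K, B, hK, hB,
    fun n m hm => ?_, fun m => ?_, fun n m hm => ?_⟩
  · have h1 := congrArg Complex.re (splineDiff_eq_saddleIntegral ht hm (lowerCutoff_eq n x))
    rw [Complex.ofReal_re, Complex.re_ofReal_mul, exp_neg_mul_rateI ht htx (lowerCutoff_eq n x)] at h1
    have h2 : 0 < Real.sqrt n := Real.sqrt_pos.2 (by exact_mod_cast (by omega : 0 < n))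
    rw [h1]
    field_simp
  · have h1 := tendsto_sqrt_mul_saddleIntegral ht hx' hs hs0 (abs_fracN_le hx hx1) m
    have h2 := (Complex.continuous_re.tendsto _).comp h1
    rw [Complex.ofReal_re, div_mul_eq_mul_div, mul_div_assoc] at h2
    refine h2.congr fun n => ?_
    rw [Function.comp_apply, Complex.re_ofReal_mul]
  · refine le_trans ?_ (hKB n m (fracN n x) hm)
    rw [abs_mul, abs_of_nonneg (Real.sqrt_nonneg _)]
    gcongr
    exact Complex.abs_re_le_norm _

theorem sum_splineDiff_isEquivalent {x y tx ty σx σy ε : ℝ} (hε : |ε| = 1)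
    (hx : 0 < x) (hx1 : x < 1) (hy : 0 < y) (hy1 : y < 1) (htx : 0 < tx) (hty : 0 < ty)
    (hdx : deriv cumulantL tx = x) (hdy : deriv cumulantL ty = y) (hσx : 0 < σx)
    (hσx2 : σx ^ 2 = deriv (deriv cumulantL) tx) (hσy : 0 < σy)
    (hσy2 : σy ^ 2 = deriv (deriv cumulantL) ty) :
    (fun n : ℕ => ∑ m ∈ Finset.range n, ε ^ m * stirlingWeight n m *
        splineDiff n m (lowerCutoff n x) * splineDiff n m (lowerCutoff n y)) ~[atTop]
      fun n : ℕ => Real.exp (-(n * rateI₂ x y) +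
        (fracN n x * tx + fracN n y * ty + ε * (1 / 2 * (tx * ty)))) /
          (2 * Real.pi * n * σx * tx * σy * ty) := by
  obtain ⟨R, K, B, hK, hB, hR, hRl, hRb⟩ := exists_splineDiff_eq hx hx1 htx hdx
  obtain ⟨R', K', B', hK', hB', hR', hRl', hRb'⟩ := exists_splineDiff_eq hy hy1 hty hdy
  have hlim := tendsto_sum_stirlingWeight hε hK hB hK' hB' hRl hRl' hRb hRb'
  rw [← hσx2, ← hσy2, Real.sqrt_div (by positivity), Real.sqrt_div (by positivity),
    Real.sqrt_sq hσx.le, Real.sqrt_sq hσy.le] at hlim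
  have hpos : 0 < Real.exp (ε * (1 / 2 * (tx * ty))) *
      (Real.sqrt (2 * Real.pi) / σx / tx * (Real.sqrt (2 * Real.pi) / σy / ty)) := by positivity
  have h1 := (isEquivalent_const_iff_tendsto hpos.ne').2 hlim
  have h2 := (IsEquivalent.refl (u := fun n : ℕ =>
    Real.exp (-(n * rateI x) + fracN n x * tx) / (2 * Real.pi * Real.sqrt n) *
    (Real.exp (-(n * rateI y) + fracN n y * ty) / (2 * Real.pi * Real.sqrt n))) (l := atTop)).mul h1
  refine (h2.congr_left ?_).congr_right ?_
  · refine Eventually.of_forall fun n => ?_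
    simp only [Pi.mul_apply]
    rw [Finset.mul_sum]
    refine Finset.sum_congr rfl fun m hm => ?_
    rw [hR n m (Finset.mem_range.1 hm), hR' n m (Finset.mem_range.1 hm)]
    ring
  · filter_upwards [eventually_gt_atTop 0] with n hn
    have hn0 : (0 : ℝ) < n := by exact_mod_cast hn
    have h3 : Real.sqrt n * Real.sqrt n = n := Real.mul_self_sqrt hn0.le
    have h4 : Real.sqrt (2 * Real.pi) * Real.sqrt (2 * Real.pi) = 2 * Real.pi :=
      Real.mul_self_sqrt (by positivity)
    simp only [Pi.mul_apply, Function.const_apply]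
    rw [rateI₂, show -(n * (rateI x + rateI y)) +
        (fracN n x * tx + fracN n y * ty + ε * (1 / 2 * (tx * ty))) =
      (-(n * rateI x) + fracN n x * tx) + (-(n * rateI y) + fracN n y * ty) +
        ε * (1 / 2 * (tx * ty)) by ring, Real.exp_add (_ + _) (ε * _),
      Real.exp_add (_ + fracN n x * tx)]
    calc _ = Real.exp (-(n * rateI x) + fracN n x * tx) * Real.exp (-(n * rateI y) + fracN n y * ty) *
          Real.exp (ε * (1 / 2 * (tx * ty))) * (Real.sqrt (2 * Real.pi) * Real.sqrt (2 * Real.pi)) /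
          (2 * Real.pi * (2 * Real.pi) * (Real.sqrt n * Real.sqrt n) * σx * tx * σy * ty) := by
          have := Real.sqrt_pos.2 hn0
          field_simp
      _ = _ := by
          rw [h3, h4]
          field_simp

/-! ### From counts to probabilities -/

theorem IsUniformPerm.measureReal_eq {Ω : Type*} [MeasurableSpace Ω] {P : Measure Ω}
    [IsProbabilityMeasure P] {n : ℕ} {X : Ω → Equiv.Perm (Fin n)} (hX : IsUniformPerm P X)
    (Q : Equiv.Perm (Fin n) → Prop) :
    P.real {ω | Q (X ω)} = (Nat.card {σ // Q σ} : ℝ) / n.factorial := by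
  classical
  have h1 : {ω | Q (X ω)} = ⋃ σ ∈ Finset.univ.filter Q, {ω | X ω = σ} := by
    ext ω
    simp
  rw [h1, measureReal_biUnion_finset, Finset.sum_congr rfl fun σ _ => (hX σ).2, Finset.sum_const,
    Nat.card_eq_fintype_card, Fintype.card_subtype, nsmul_eq_mul, mul_one_div]
  · intro σ _ τ _ hστ
    refine Set.disjoint_left.2 fun ω h h' => hστ ?_
    exact h.symm.trans h'
  · exact fun σ _ => (hX σ).1

/-- This and the next lemma show that the upper tail at `x` and the lower tail at `1 - x` are
governed by the same integer cutoff, so one asymptotic expansion serves all four events. -/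
theorem le_div_iff_lowerCutoff {n : ℕ} (hn : 1 ≤ n) (d : ℕ) (x : ℝ) :
    x ≤ (d : ℝ) / (((n + 1 : ℕ) : ℝ) - 1) ↔ (n + 1 : ℕ) - lowerCutoff (n + 1) x ≤ (d : ℤ) := by
  have hn' : (0 : ℝ) < ((n + 1 : ℕ) : ℝ) - 1 := by
    push_cast
    rw [add_sub_cancel_right]
    exact_mod_cast hn
  rw [le_div_iff₀ hn', lowerCutoff, sub_sub_cancel, Int.ceil_le, mul_comm]
  norm_cast

theorem div_le_iff_lowerCutoff {n : ℕ} (hn : 1 ≤ n) (d : ℕ) (x : ℝ) :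
    (d : ℝ) / (((n + 1 : ℕ) : ℝ) - 1) ≤ 1 - x ↔ (d : ℤ) < lowerCutoff (n + 1) x := by
  have hn' : (0 : ℝ) < ((n + 1 : ℕ) : ℝ) - 1 := by
    push_cast
    rw [add_sub_cancel_right]
    exact_mod_cast hn
  have h1 : (d : ℤ) < lowerCutoff (n + 1) x ↔ ⌈(((n + 1 : ℕ) : ℝ) - 1) * x⌉ ≤ (n : ℤ) - d := by
    rw [lowerCutoff]
    push_cast
    omega
  rw [div_le_iff₀ hn', h1, Int.ceil_le]
  push_cast
  constructor <;> intro h <;> linarith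

theorem card_descents_lt_div (n : ℕ) (a b : ℤ) :
    (Nat.card {σ : Equiv.Perm (Fin (n + 1)) // (descents σ : ℤ) < a ∧ (descents σ⁻¹ : ℤ) < b} : ℝ) /
      (n + 1).factorial = ∑ m ∈ Finset.range (n + 1), 1 ^ m * stirlingWeight (n + 1) m *
      splineDiff (n + 1) m a * splineDiff (n + 1) m b := by
  have h : ((n + 1).factorial : ℝ) ≠ 0 := by positivity
  rw [card_descents_lt, div_eq_iff h, Finset.sum_mul]
  exact Finset.sum_congr rfl fun m _ => by ring

theorem card_descents_lt_le_div (n : ℕ) (a b : ℤ) :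
    (Nat.card {σ : Equiv.Perm (Fin (n + 1)) //
        (descents σ : ℤ) < a ∧ (n + 1 : ℕ) - b ≤ (descents σ⁻¹ : ℤ)} : ℝ) /
      (n + 1).factorial = ∑ m ∈ Finset.range (n + 1), (-1) ^ m * stirlingWeight (n + 1) m *
      splineDiff (n + 1) m a * splineDiff (n + 1) m b := by
  have h : ((n + 1).factorial : ℝ) ≠ 0 := by positivity
  rw [card_descents_lt_le, div_eq_iff h, Finset.sum_mul, sub_sub_cancel]
  exact Finset.sum_congr rfl fun m _ => by ring

theorem theorem4p2 {Ω : Type*} [MeasurableSpace Ω] (P : Measure Ω) [IsProbabilityMeasure P]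
    (π : (n : ℕ) → Ω → Equiv.Perm (Fin n)) (hπ : ∀ n : ℕ, IsUniformPerm P (π n))
    (D D' : ℕ → Ω → ℕ) (hD : ∀ n ω, D n ω = descents (π n ω))
    (hD' : ∀ n ω, D' n ω = descents (π n ω)⁻¹)
    (x y : ℝ) (hx : 1 / 2 < x) (hx1 : x < 1) (hy : 1 / 2 < y) (hy1 : y < 1) :
    -- the suprema defining `I(x)` and `I(y)` are finite
    BddAbove (Set.range fun t : ℝ => x * t - cumulantL t) ∧
    BddAbove (Set.range fun t : ℝ => y * t - cumulantL t) ∧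
    ∃ tx ty σx σy : ℝ,
      -- `tx`, `ty` are the unique solutions of `L'(tx) = x`, `L'(ty) = y`
      (deriv cumulantL tx = x ∧ ∀ t : ℝ, deriv cumulantL t = x → t = tx) ∧
      (deriv cumulantL ty = y ∧ ∀ t : ℝ, deriv cumulantL t = y → t = ty) ∧
      0 < tx ∧ 0 < ty ∧
      0 < σx ∧ σx ^ 2 = deriv (deriv cumulantL) tx ∧
      0 < σy ∧ σy ^ 2 = deriv (deriv cumulantL) ty ∧
      (fun n : ℕ => P.real {ω | x ≤ (D n ω : ℝ) / ((n : ℝ) - 1) ∧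
          y ≤ (D' n ω : ℝ) / ((n : ℝ) - 1)})
        ~[atTop] (fun n : ℕ =>
          Real.exp (-(n * rateI₂ x y) + (fracN n x * tx + fracN n y * ty + 1 / 2 * (tx * ty))) /
            (2 * Real.pi * n * σx * tx * σy * ty)) ∧
      (fun n : ℕ => P.real {ω | (D n ω : ℝ) / ((n : ℝ) - 1) ≤ 1 - x ∧
          (D' n ω : ℝ) / ((n : ℝ) - 1) ≤ 1 - y})
        ~[atTop] (fun n : ℕ =>
          Real.exp (-(n * rateI₂ x y) + (fracN n x * tx + fracN n y * ty + 1 / 2 * (tx * ty))) /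
            (2 * Real.pi * n * σx * tx * σy * ty)) ∧
      (fun n : ℕ => P.real {ω | (D n ω : ℝ) / ((n : ℝ) - 1) ≤ 1 - x ∧
          y ≤ (D' n ω : ℝ) / ((n : ℝ) - 1)})
        ~[atTop] (fun n : ℕ =>
          Real.exp (-(n * rateI₂ x y) + (fracN n x * tx + fracN n y * ty - 1 / 2 * (tx * ty))) /
            (2 * Real.pi * n * σx * tx * σy * ty)) ∧
      (fun n : ℕ => P.real {ω | x ≤ (D n ω : ℝ) / ((n : ℝ) - 1) ∧
          (D' n ω : ℝ) / ((n : ℝ) - 1) ≤ 1 - y})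
        ~[atTop] (fun n : ℕ =>
          Real.exp (-(n * rateI₂ x y) + (fracN n x * tx + fracN n y * ty - 1 / 2 * (tx * ty))) /
            (2 * Real.pi * n * σx * tx * σy * ty)) := by
  obtain ⟨tx, htx, hdx, hux⟩ := exists_unique_deriv_cumulantL hx hx1
  obtain ⟨ty, hty, hdy, huy⟩ := exists_unique_deriv_cumulantL hy hy1
  have hsx : 0 < deriv (deriv cumulantL) tx :=
    (hasDerivAt_deriv_cumulantL htx).deriv ▸ one_div_sq_sub_expRatio_pos htx
  have hsy : 0 < deriv (deriv cumulantL) ty :=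
    (hasDerivAt_deriv_cumulantL hty).deriv ▸ one_div_sq_sub_expRatio_pos hty
  have hx0 : 0 < x := by linarith
  have hy0 : 0 < y := by linarith
  have hpos := sum_splineDiff_isEquivalent (ε := 1) (by simp) hx0 hx1 hy0 hy1 htx hty hdx hdy
    (Real.sqrt_pos.2 hsx) (Real.sq_sqrt hsx.le) (Real.sqrt_pos.2 hsy) (Real.sq_sqrt hsy.le)
  have hneg := sum_splineDiff_isEquivalent (ε := -1) (by simp) hx0 hx1 hy0 hy1 htx hty hdx hdy
    (Real.sqrt_pos.2 hsx) (Real.sq_sqrt hsx.le) (Real.sqrt_pos.2 hsy) (Real.sq_sqrt hsy.le)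
  simp only [neg_mul, one_mul, ← sub_eq_add_neg] at hpos hneg
  refine ⟨bddAbove_range_mul_sub_cumulantL htx.ne' hdx,
    bddAbove_range_mul_sub_cumulantL hty.ne' hdy, tx, ty,
    Real.sqrt (deriv (deriv cumulantL) tx), Real.sqrt (deriv (deriv cumulantL) ty),
    ⟨hdx, hux⟩, ⟨hdy, huy⟩, htx, hty, Real.sqrt_pos.2 hsx, Real.sq_sqrt hsx.le,
    Real.sqrt_pos.2 hsy, Real.sq_sqrt hsy.le, hpos.congr_left ?_, hpos.congr_left ?_,
    hneg.congr_left ?_, hneg.congr_left ?_⟩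
  all_goals
    -- From size `2` on the denominator `n - 1` is positive.
    filter_upwards [eventually_ge_atTop 2] with n hn
    obtain ⟨n, rfl⟩ : ∃ k, n = k + 1 := ⟨n - 1, by omega⟩
    simp only [hD, hD', le_div_iff_lowerCutoff (by omega : 1 ≤ n),
      div_le_iff_lowerCutoff (by omega : 1 ≤ n)]
  · rw [(hπ (n + 1)).measureReal_eq (fun σ => _ ≤ (descents σ : ℤ) ∧ _ ≤ (descents σ⁻¹ : ℤ)),
      card_descents_ge_ge, sub_sub_cancel, sub_sub_cancel, card_descents_lt_div]
  · rw [(hπ (n + 1)).measureReal_eq (fun σ => (descents σ : ℤ) < _ ∧ (descents σ⁻¹ : ℤ) < _),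
      card_descents_lt_div]
  · rw [(hπ (n + 1)).measureReal_eq (fun σ => (descents σ : ℤ) < _ ∧ _ ≤ (descents σ⁻¹ : ℤ)),
      card_descents_lt_le_div]
  · rw [(hπ (n + 1)).measureReal_eq (fun σ => _ ≤ (descents σ : ℤ) ∧ (descents σ⁻¹ : ℤ) < _),
      card_descents_ge_lt, card_descents_lt_le_div]
    -- Passing to the inverse permutation exchanged the roles of `x` and `y`; the sum is symmetric
    -- in them.
    exact Finset.sum_congr rfl fun m _ => by ring
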